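/- **Setting.** Let $T>0$, let $\tau\ge 1$, $d\ge 0$ be integers, and let $e_k(u)=T^{-1/2}e^{2\pi i n_k u/T}$, $n_k=(-1)^k[k/2]$, $k=1,2,\dots$. Let $K\subseteq\{1,2,\dots\}$ be the set of components that are present (finite or infinite). For a process $\xi(t)$ put $\xi^{(d)}(t,\tau T)=\sum_{l=0}^d(-1)^l\binom dl\xi(t-l\tau T)$ and $\xi^{(d)}_{kj}=\int_0^T\xi^{(d)}(u+jT,\tau T)\overline{e_k(u)}\,du$. A *spectral density* is a measurable function $f$ on $[-\pi,\pi)$ whose values are positive operators on $\ell^2(K)$, with $\int_{-\pi}^{\pi}|\chi(\lambda)|^2\,\mathrm{Tr} f(\lambda)\,d\lambda<\infty$, where $\chi(\lambda)=(1-e^{-i\lambda\tau})^d/(i\lambda)^d$. The process $\xi$ has density $f$ if its components $\xi^{(d)}_{kj}$ have mean zero, vanish for $k\notin K$, and satisfy $\mathsf E\,\xi^{(d)}_{kl}\overline{\xi^{(d)}_{nj}}=\frac1{2\pi}\int_{-\pi}^{\pi}e^{i(l-j)\lambda}|\chi(\lambda)|^2\langle f(\lambda)\delta_k,\delta_n\rangle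 d\lambda$ for $k,n\in K$ (and $\xi$ is measurable with increments square integrable over $\Omega\times[jT,(j+1)T)$). The *minimality condition* for $f$ is: $f(\lambda)$ is invertible for almost all $\lambda$ and $\int_{-\pi}^{\pi}\mathrm{Tr}\big[\lambda^{2d}|1-e^{i\lambda\tau}|^{-2d}f^{-1}(\lambda)\big]d\lambda<\infty$. Let $a(t)$, $t\ge0$, be locally integrable, let $\vec a_j$ have the entries $\int_0^T a(u+jT)\,e_k(u)\,du$, $k\in K$, and let $\vec b_j=(D^\tau\mathbf a)_j=\sum_{m\ge0}d_\tau(m)\vec a_{j+m}$, where $\sum_m d_\tau(m)x^m=(\sum_j x^{\tau j})^d$; assume that these series converge entrywise to vectors $\vec b_j\in\ell^2(K)$ with $\sum_{j\ge0}(j+1)\|\vec b_j\|<\infty$. Estimating $A\xi=\int_0^\infty a(t)\xi(t)dt$ from $\xi(t)$, $t<0$, means estimating $B\xi=\sum_j\vec b_j^{\top}\vec\xi^{(d)}_j$ by elements of the closed linear span of $\xi^{(d)}_{kj}$, $j\le-1$, since $A\xi-B\xi$ depends only on observed values. Put $B(\lambda)=\sum_{j\ge 0}\vec b_je^{ij\lambda}$;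 let $L_2^{0-}(f)$ be the closed linear span of the functions $e^{ij\lambda}\chi(\lambda)\delta_k$, $j\le-1$, $k\in K$, in the space $L_2(f)$ with norm $\big(\frac1{2\pi}\int\langle f g,g\rangle d\lambda\big)^{1/2}$, and put $\Delta(h;f)=\frac1{2\pi}\int_{-\pi}^{\pi}\langle f(\chi B-h),\chi B-h\rangle d\lambda$ and $\Delta(f)=\min_{h\in L_2^{0-}(f)}\Delta(h;f)=\Delta(h_\tau(f);f)$. For $f$ satisfying the minimality condition let $\mathbf F_\tau$ be the positive self-adjoint operator in $\ell^2(\mathbb N;\ell^2(K))$ determined by the block matrix $F^\tau_{j,l}=\frac1{2\pi}\int_{-\pi}^{\pi}e^{-i\lambda(j-l)}\lambda^{2d}|1-e^{i\lambda\tau}|^{-2d}f^{-1}(\lambda)d\lambda$, that is, the operator of the closed quadratic form $\mathbf c\mapsto\frac1{2\pi}\int\lambda^{2d}|1-e^{i\lambda\tau}|^{-2d}\langle f^{-1}C,C\rangle d\lambda$, $C=\sum_{j\ge 0} c_je^{ij\lambda}$, on all $\mathbf c\in\ell^2$ where it is finite. Let $\mathcal D$ be a class of spectral densities; $f_0\in\mathcal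 D$ is *least favourable* if $\Delta(f_0)=\max_{f\in\mathcal D}\Delta(f)$; $h^0\in H_{\mathcal D}=\bigcap_{f\in\mathcal D}L_2^{0-}(f)$ is *minimax* if $\sup_{f\in\mathcal D}\Delta(h^0;f)=\min_{h\in H_{\mathcal D}}\sup_{f\in\mathcal D}\Delta(h;f)$. **Statement.** Let $f_0\in\mathcal D$ satisfy the minimality condition. 1. For each $f\in\mathcal D$ satisfying the minimality condition the equation $\mathbf F_\tau\mathbf c=D^\tau\mathbf a$ has exactly one solution $\mathbf c=\mathbf F_\tau^{-1}D^\tau\mathbf a$; and for each $f\in\mathcal D$ and each process with density $f$ the mean square error of the optimal linear estimate is $\Delta(f)$. 2. Suppose that the operator $\mathbf F^0_\tau$ of $f_0$ solves $$\max_{f}\langle D^\tau\mathbf a,\mathbf F_\tau^{-1}D^\tau\mathbf a\rangle=\langle D^\tau\mathbf a,(\mathbf F^0_\tau)^{-1}D^\tau\mathbf a\rangle,$$ the maximum being over the $f\in\mathcal D$ that satisfy the minimality condition. If all $f\in\mathcal D$ satisfy the minimality condition, or if $\mathcal D$ is convex, then $f_0$ is least favourable in $\mathcal D$. The optimal spectral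 characteristic for $f_0$ is $$h_\tau(f_0)=B(\lambda)\frac{(1-e^{-i\lambda\tau})^d}{(i\lambda)^d}-\frac{(-i\lambda)^d}{(1-e^{i\lambda\tau})^d}f_0^{-1}(\lambda)\sum_{j\ge0}\big((\mathbf F^0_\tau)^{-1}D^\tau\mathbf a\big)_je^{ij\lambda},$$ and if $\mathcal D$ is convex and $h_\tau(f_0)\in H_{\mathcal D}$, then $h_\tau(f_0)$ is minimax. -/

import Mathlib

open MeasureTheory Filter Topology

noncomputable section

namespace Extrapolation

/-! ### Fourier basis on a period and the coefficients of the functional -/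

/-- The integer frequency `(-1)^k [k/2]` of the `k`-th basis function
`e_k(u) = T^(-1/2) exp(2 π i (-1)^k [k/2] u / T)`, `k = 1, 2, 3, …`. -/
def freq (k : ℕ+) : ℤ := (-1) ^ (k : ℕ) * (((k : ℕ) / 2 : ℕ) : ℤ)

/-- The `n`-th Fourier coefficient `T^(-1/2) ∫_0^T x(u + jT) exp(-2 π i n u / T) du` of the
`j`-th block of the function `x`. -/
def blockCoeff (T : ℝ) (x : ℝ → ℂ) (j n : ℤ) : ℂ :=
  ((1 / Real.sqrt T : ℝ) : ℂ) *
    ∫ u in (0 : ℝ)..T, x (u + j * T) *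
      Complex.exp (-(2 * Real.pi * Complex.I * n * u / T))

/-- The `k`-th entry of the vector `a_j = (a_{1j}, a_{3j}, a_{2j}, a_{5j}, a_{4j}, …)`: the
reordering puts at the place `k` the Fourier coefficient of frequency `- freq k`, the one that is
paired with the `k`-th component of the increments in `∫ a ξ`. -/
def aCoeff (T : ℝ) (a : ℝ → ℂ) (k : ℕ+) (j : ℕ) : ℂ := blockCoeff T a j (-(freq k))

/-- The numbers `d_τ(m)`, given by `∑ d_τ(m) x^m = (∑ x^(τ j))^d`. -/
def dTau (τ d m : ℕ) : ℂ :=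
  PowerSeries.coeff m ((PowerSeries.mk fun i => if τ ∣ i then (1 : ℂ) else 0) ^ d)

/-- The Hilbert space `ℓ²(K)`, where `K ⊆ {1, 2, 3, …}` is the set of the components that are
present in the increment sequence. -/
abbrev Vec (K : Set ℕ+) : Type := lp (fun _ : K => ℂ) 2

/-- The standard basis vector. -/
def basisVec {K : Set ℕ+} (k : K) : Vec K := lp.single 2 k (1 : ℂ)

/-- `b = D^τ a`, that is `b_j = ∑_{m ≥ 0} d_τ(m) a_{j+m}`, entry by entry. -/
def IsDTau {K : Set ℕ+} (T : ℝ) (τ d : ℕ) (a : ℝ → ℂ) (b : ℕ → Vec K) : Prop :=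
  ∀ (j : ℕ) (k : K),
    Tendsto (fun N : ℕ => ∑ m ∈ Finset.range N, dTau τ d m * aCoeff T a k (j + m)) atTop
      (𝓝 (b j k))

/-! ### Spectral densities -/

/-- Lebesgue measure on `[-π, π)`. -/
def circ : Measure ℝ := volume.restrict (Set.Ico (-Real.pi) Real.pi)

/-- `χ(λ) = (1 - e^{-iλτ})^d / (iλ)^d`. -/
def chi (τ d : ℕ) (x : ℝ) : ℂ :=
  (1 - Complex.exp (-(Complex.I * x * τ))) ^ d / (Complex.I * x) ^ d

/-- The weight `λ^{2d} / |1 - e^{iλτ}|^{2d}`. -/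
def weight (τ d : ℕ) (x : ℝ) : ℝ :=
  x ^ (2 * d) / ‖1 - Complex.exp (Complex.I * x * τ)‖ ^ (2 * d)

/-- The trace of a positive operator. -/
def trace {K : Set ℕ+} (A : Vec K →L[ℂ] Vec K) : ENNReal :=
  ∑' k : K, ENNReal.ofReal (inner ℂ (basisVec k) (A (basisVec k))).re

/-- Spectral densities of increment sequences: (weakly) measurable functions on `[-π, π)` whose
values are positive operators, with `∫ |1-e^{iλτ}|^{2d} λ^{-2d} Tr f(λ) dλ < ∞`. -/
structure IsSpectralDensity {K : Set ℕ+} (τ d : ℕ) (f : ℝ → Vec K →L[ℂ] Vec K) : Prop where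
  measurable : ∀ v : Vec K, AEStronglyMeasurable (fun x => f x v) circ
  positive : ∀ᵐ x ∂circ, (f x).IsPositive
  kernel : ∫⁻ x, ENNReal.ofReal (‖chi τ d x‖ ^ 2) * trace (f x) ∂circ < ⊤

/-- The minimality condition `∫ Tr [λ^{2d} |1-e^{iλτ}|^{-2d} f⁻¹(λ)] dλ < ∞`. -/
def Minimality {K : Set ℕ+} (τ d : ℕ) (f : ℝ → Vec K →L[ℂ] Vec K) : Prop :=
  (∀ᵐ x ∂circ, IsUnit (f x)) ∧
    ∫⁻ x, ENNReal.ofReal (weight τ d x) * trace (Ring.inverse (f x)) ∂circ < ⊤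

/-! ### Estimates and mean square errors in the spectral domain -/

/-- The squared norm `(1/2π) ∫ ⟨f g, g⟩ dλ` of `L_2(f)`. With `f_{kn} = ⟨f e_k, e_n⟩` one has
`⟨f g, g⟩ = gᵀ f ḡ`. -/
def sqNorm {K : Set ℕ+} (f : ℝ → Vec K →L[ℂ] Vec K) (g : ℝ → Vec K) : ENNReal :=
  ENNReal.ofReal (1 / (2 * Real.pi)) *
    ∫⁻ x, ENNReal.ofReal (inner ℂ (g x) (f x (g x))).re ∂circ

/-- A finite linear combination of the functions `e^{iλj} χ(λ) δ_k`, `j ≤ -1`, `k ∈ K`; the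
index `(k, m)` stands for `j = -(m+1)`. -/
def pastComb {K : Set ℕ+} (τ d : ℕ) (α : K × ℕ →₀ ℂ) (x : ℝ) : Vec K :=
  α.sum fun p z =>
    (z * Complex.exp (-(Complex.I * x * ((p.2 : ℂ) + 1))) * chi τ d x) • basisVec p.1

/-- The subspace `L_2^{0-}(f)`: the closed linear span in `L_2(f)` of the functions
`e^{iλj} χ(λ) δ_k`, `j ≤ -1`. -/
def L2Past {K : Set ℕ+} (τ d : ℕ) (f : ℝ → Vec K →L[ℂ] Vec K) : Set (ℝ → Vec K) :=
  {h | AEStronglyMeasurable h circ ∧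
    ∀ ε : ENNReal, 0 < ε → ∃ α : K × ℕ →₀ ℂ, sqNorm f (fun x => h x - pastComb τ d α x) < ε}

/-- `H_D`, the intersection of the spaces `L_2^{0-}(f)`, `f ∈ D`. -/
def HD {K : Set ℕ+} (τ d : ℕ) (D : Set (ℝ → Vec K →L[ℂ] Vec K)) : Set (ℝ → Vec K) :=
  {h | ∀ f ∈ D, h ∈ L2Past τ d f}

/-- `B(e^{iλ}) = ∑_j b_j e^{iλj}`. -/
def Bfun {K : Set ℕ+} (b : ℕ → Vec K) (x : ℝ) : Vec K :=
  ∑' j : ℕ, Complex.exp (Complex.I * x * j) • b j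

/-- `Δ(h; f)`: the mean square error of the estimate with the spectral characteristic `h` when
the spectral density is `f`. -/
def err {K : Set ℕ+} (τ d : ℕ) (b : ℕ → Vec K) (h : ℝ → Vec K)
    (f : ℝ → Vec K →L[ℂ] Vec K) : ENNReal :=
  sqNorm f (fun x => chi τ d x • Bfun b x - h x)

/-- `Δ(f)`, the least value of `Δ(h; f)` over the linear estimates `h ∈ L_2^{0-}(f)`. -/
def minErr {K : Set ℕ+} (τ d : ℕ) (b : ℕ → Vec K) (f : ℝ → Vec K →L[ℂ] Vec K) : ENNReal :=
  ⨅ h ∈ L2Past τ d f, err τ d b h f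

/-- `h` is the spectral characteristic `h_τ(f)` of the optimal linear estimate. -/
def IsOptimal {K : Set ℕ+} (τ d : ℕ) (b : ℕ → Vec K) (f : ℝ → Vec K →L[ℂ] Vec K)
    (h : ℝ → Vec K) : Prop :=
  h ∈ L2Past τ d f ∧ err τ d b h f = minErr τ d b f

/-- `f₀` is least favourable in `D`: `Δ(f₀) = max_{f ∈ D} Δ(f)`. -/
def IsLeastFavourable {K : Set ℕ+} (τ d : ℕ) (b : ℕ → Vec K)
    (D : Set (ℝ → Vec K →L[ℂ] Vec K)) (f₀ : ℝ → Vec K →L[ℂ] Vec K) : Prop :=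
  f₀ ∈ D ∧ ∀ f ∈ D, minErr τ d b f ≤ minErr τ d b f₀

/-- `h₀` is minimax-robust: `h₀ ∈ H_D` and `sup_{f ∈ D} Δ(h₀; f) = min_{h ∈ H_D} sup_{f ∈ D} Δ(h; f)`. -/
def IsMinimax {K : Set ℕ+} (τ d : ℕ) (b : ℕ → Vec K)
    (D : Set (ℝ → Vec K →L[ℂ] Vec K)) (h₀ : ℝ → Vec K) : Prop :=
  h₀ ∈ HD τ d D ∧ ∀ h ∈ HD τ d D, ⨆ f ∈ D, err τ d b h₀ f ≤ ⨆ f ∈ D, err τ d b h f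

/-! ### The operator `F_τ` -/

/-- The block `F_{j,l}`, as the form `⟨F_{j,l} u, v⟩`: the Fourier coefficient
`(1/2π) ∫ e^{-iλ(j-l)} λ^{2d} |1-e^{iλτ}|^{-2d} ⟨f⁻¹(λ) u, v⟩ dλ`. -/
def fourierBlock {K : Set ℕ+} (τ d : ℕ) (f : ℝ → Vec K →L[ℂ] Vec K) (j l : ℕ)
    (u v : Vec K) : ℂ :=
  (1 / (2 * Real.pi) : ℂ) * ∫ x, Complex.exp (-(Complex.I * x * ((j : ℂ) - l))) *
    (weight τ d x : ℂ) * inner ℂ v (Ring.inverse (f x) u) ∂circ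

/-- The sesquilinear form of `F_τ`, `⟨F_τ c, v⟩ = ∑_{l,j} ⟨F_{l,j} c_j, v_l⟩`, written with
`C(λ) = ∑ c_j e^{iλj}` and `V(λ) = ∑ v_l e^{iλl}`. -/
def toeplitzForm {K : Set ℕ+} (τ d : ℕ) (f : ℝ → Vec K →L[ℂ] Vec K) (C V : ℝ → Vec K) : ℂ :=
  (1 / (2 * Real.pi) : ℂ) *
    ∫ x, (weight τ d x : ℂ) * inner ℂ (V x) (Ring.inverse (f x) (C x)) ∂circ

/-- On the sequences with one nonzero entry the form is given by the matrix `(F_{l,j})`. -/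
theorem toeplitzForm_exp {K : Set ℕ+} (τ d : ℕ) (f : ℝ → Vec K →L[ℂ] Vec K) (j l : ℕ)
    (u v : Vec K) :
    toeplitzForm τ d f (fun x => Complex.exp (Complex.I * x * j) • u)
      (fun x => Complex.exp (Complex.I * x * l) • v) = fourierBlock τ d f l j u v := by
  unfold toeplitzForm fourierBlock
  congr 2
  funext x
  have h : (starRingEnd ℂ) (Complex.exp (Complex.I * x * l)) *
      Complex.exp (Complex.I * x * j) = Complex.exp (-(Complex.I * x * ((l : ℂ) - j))) := by
    rw [← Complex.exp_conj, ← Complex.exp_add]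
    congr 1
    simp
    ring
  rw [map_smul, inner_smul_left, inner_smul_right, ← h]
  ring

/-- `C ∈ L²` has the Fourier series `∑_{j ≥ 0} c_j e^{iλj}`; so `c` runs over the
square-summable sequences. -/
structure HasSeries {K : Set ℕ+} (C : ℝ → Vec K) (c : ℕ → Vec K) : Prop where
  memLp : MemLp C 2 circ
  coeff : ∀ j : ℕ, (1 / (2 * Real.pi) : ℂ) •
    ∫ x, Complex.exp (-(Complex.I * x * j)) • C x ∂circ = c j
  coeff_neg : ∀ j : ℕ, ∫ x, Complex.exp (Complex.I * x * ((j : ℂ) + 1)) • C x ∂circ = 0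

/-- `⟨F_τ c, c⟩ < ∞`. -/
def FiniteForm {K : Set ℕ+} (τ d : ℕ) (f : ℝ → Vec K →L[ℂ] Vec K) (C : ℝ → Vec K) : Prop :=
  Integrable (fun x => (weight τ d x : ℂ) * inner ℂ (C x) (Ring.inverse (f x) (C x))) circ

/-- `⟨b, c⟩ = ∑_j ⟨b_j, c_j⟩`, linear in `b`. -/
def seqInner {K : Set ℕ+} (b c : ℕ → Vec K) : ℂ := ∑' j : ℕ, inner ℂ (c j) (b j)

/-- `F_τ c = b`. As its symbol `λ^{2d} |1-e^{iλτ}|^{-2d} f⁻¹(λ)` is positive and only integrable,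
the matrix `(F_{l,j})` may define an unbounded operator: `F_τ` is the positive self-adjoint
operator in `ℓ²` of its closed quadratic form, i.e. `F_τ c = b` means that `c` lies in the form
domain and `⟨F_τ c, v⟩ = ⟨b, v⟩` for all `v` of the form domain. With `v = δ_l u` this contains
the equations `∑_j F_{l,j} c_j = b_l`, `l ≥ 0`; for a bounded symbol it is the usual bounded
block Toeplitz operator. -/
def ToeplitzMaps {K : Set ℕ+} (τ d : ℕ) (f : ℝ → Vec K →L[ℂ] Vec K) (c b : ℕ → Vec K) : Prop :=
  ∃ C : ℝ → Vec K, HasSeries C c ∧ FiniteForm τ d f C ∧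
    ∀ (v : ℕ → Vec K) (V : ℝ → Vec K), HasSeries V v → FiniteForm τ d f V →
      toeplitzForm τ d f C V = seqInner b v

/-- The formula
`h = B(e^{iλ}) (1-e^{-iλτ})^d / (iλ)^d - (-iλ)^d / (1-e^{iλτ})^d f⁻¹(λ) C(e^{iλ})`. -/
def hTau {K : Set ℕ+} (τ d : ℕ) (b : ℕ → Vec K) (f : ℝ → Vec K →L[ℂ] Vec K)
    (C : ℝ → Vec K) (x : ℝ) : Vec K :=
  chi τ d x • Bfun b x -
    ((-(Complex.I * x)) ^ d / (1 - Complex.exp (Complex.I * x * τ)) ^ d) •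
      Ring.inverse (f x) (C x)

/-! ### The stochastic process -/

/-- The increment `ξ^{(d)}(t, s) = ∑_{l ≤ d} (-1)^l (d choose l) ξ(t - l s)`. -/
def increment {Ω : Type*} (d : ℕ) (s : ℝ) (ξ : ℝ → Ω → ℂ) (t : ℝ) (ω : Ω) : ℂ :=
  ∑ l ∈ Finset.range (d + 1), (-1) ^ l * (d.choose l : ℂ) * ξ (t - l * s) ω

/-- The component `ξ^{(d)}_{kj}` of the generated vector increment sequence (step `τT`). -/
def component {Ω : Type*} (T : ℝ) (τ d : ℕ) (ξ : ℝ → Ω → ℂ) (k : ℕ+) (j : ℤ) (ω : Ω) : ℂ :=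
  blockCoeff T (fun t => increment d (τ * T) ξ t ω) j (freq k)

/-- The increments of `ξ` generate a stationary vector sequence with spectral density `f`, the
components outside `K` being zero. -/
structure HasSpectralDensity {Ω : Type*} [MeasurableSpace Ω] (P : Measure Ω) {K : Set ℕ+}
    (T : ℝ) (τ d : ℕ) (ξ : ℝ → Ω → ℂ) (f : ℝ → Vec K →L[ℂ] Vec K) : Prop where
  measurable : Measurable (Function.uncurry ξ)
  sq_integrable : ∀ j : ℤ,
    ∫⁻ ω, (∫⁻ u in Set.Ico (0 : ℝ) T, ‖increment d (τ * T) ξ (u + j * T) ω‖ₑ ^ 2) ∂P < ⊤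
  mean_zero : ∀ (k : ℕ+) (j : ℤ), ∫ ω, component T τ d ξ k j ω ∂P = 0
  vanish : ∀ (k : ℕ+) (j : ℤ), k ∉ K → component T τ d ξ k j =ᵐ[P] 0
  covariance : ∀ (k n : K) (l j : ℤ),
    ∫ ω, component T τ d ξ k l ω * (starRingEnd ℂ) (component T τ d ξ n j ω) ∂P =
      (1 / (2 * Real.pi) : ℂ) * ∫ x, Complex.exp (Complex.I * x * ((l : ℂ) - j)) *
        ((‖chi τ d x‖ ^ 2 : ℝ) : ℂ) * inner ℂ (basisVec n) (f x (basisVec k)) ∂circ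

/-- The functional `Bξ = ∑_j b_jᵀ ξ^{(d)}_j`. One has `Aξ = Bξ - Vξ` with `Vξ` a functional of the
observed values of `ξ`, so that the errors for `Aξ` and for `Bξ` coincide. -/
def functionalB {Ω : Type*} {K : Set ℕ+} (T : ℝ) (τ d : ℕ) (b : ℕ → Vec K) (ξ : ℝ → Ω → ℂ)
    (ω : Ω) : ℂ :=
  ∑' j : ℕ, ∑' k : K, b j k * component T τ d ξ k j ω

/-- The mean square error of the optimal linear estimate: the squared distance in `L_2(P)` from
`Bξ` to the closed linear span of the past components `ξ^{(d)}_{kj}`, `j ≤ -1`. -/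
def extrapolationError {Ω : Type*} [MeasurableSpace Ω] (P : Measure Ω) {K : Set ℕ+}
    (T : ℝ) (τ d : ℕ) (b : ℕ → Vec K) (ξ : ℝ → Ω → ℂ) : ENNReal :=
  ⨅ α : K × ℕ →₀ ℂ, ∫⁻ ω, ‖functionalB T τ d b ξ ω -
    α.sum fun p z => z * component T τ d ξ p.1 (-((p.2 : ℤ) + 1)) ω‖ₑ ^ 2 ∂P

end Extrapolation

end

noncomputable section

namespace Extrapolation

section

/-! ### The normalized Lebesgue measure on `[-π, π)` and uniqueness of Fourier coefficients -/

/-! Put R = χ f^{1/2}. Multiplication by f^{1/2} carries L_2(f) isometrically into ordinary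
vector-valued L² on the circle. The past becomes the closed span N of e^{ijx} R δ_k, j ≤ -1, the
target becomes RB, and the prediction error is U = RB - P_N RB. Minimality forces K to be finite
(`finite_of_minimality`), since an invertible operator with finite trace lives on a
finite-dimensional space.

Let C = R*U. Orthogonality of U to N says exactly that the negative Fourier coefficients of C
vanish. The form of F_τ is the L² inner product of (R*)⁻¹C and (R*)⁻¹V. For V in the form domain
(R*)⁻¹V is orthogonal to N, so pairing it with U gives the same as pairing it with RB, namely ⟨b,
v⟩. Hence the coefficients of C solve F_τ c = b (`toeplitzForm_solutionFun`). Positivity gives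
uniqueness, ⟨b, c⟩ = ‖U‖² = Δ(f), and solving U = (R*)⁻¹C for the estimate yields the formula for
h_τ.

The delicate point is that C lies in L²: a product of two L² functions is a priori only in L¹. It is
resolved by showing that U is essentially bounded. A one-step error Y is orthogonal to all
e^{-inx}Y, n ≥ 1, so ‖Y(x)‖² has only its zeroth Fourier coefficient and is constant. By induction
the j-step error is bounded by (j+1) times the norm of the predicted vector
(`ae_norm_rot_sub_starProjection_le`), and the sum of (j+1)‖b_j‖ is finite.

For a fixed finite combination of the past the error is affine in f, so Δ, an infimum of such
functions, is concave. Mixing any f with f₀ restores minimality because inversion reverses the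
operator order. Maximality over the minimal densities therefore extends to a convex class
(`minErr_le_of_convex`). For the minimax property, near-optimal combinations for (1-t)f₀ + tf are
forced by Pythagoras to converge to h_τ(f₀) in L_2(f₀) as t → 0, while their errors at f are at most
Δ(f₀) + t. Fatou's lemma gives Δ(h_τ(f₀); f) ≤ Δ(f₀), a saddle point (`err_hTau_le_of_convex`).

Finally, the components of the process and the functions e^{ijx} R δ_k have the same Gram matrix, so
time-domain and spectral distances agree (`extrapolationError_eq_minErr`). -/

/-- The unimodular function `e^{ijx}`. -/
def unimod (j : ℤ) (x : ℝ) : ℂ := Complex.exp (Complex.I * x * j)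

lemma continuous_unimod (j : ℤ) : Continuous (unimod j) := by
  unfold unimod; fun_prop

@[simp] lemma norm_unimod (j : ℤ) (x : ℝ) : ‖unimod j x‖ = 1 := by
  have : Complex.I * x * j = ((x * j : ℝ) : ℂ) * Complex.I := by push_cast; ring
  rw [unimod, this, Complex.norm_exp_ofReal_mul_I]

lemma unimod_add (j k : ℤ) (x : ℝ) : unimod (j + k) x = unimod j x * unimod k x := by
  rw [unimod, unimod, unimod, ← Complex.exp_add]
  congr 1; push_cast; ring

@[simp] lemma unimod_zero (x : ℝ) : unimod 0 x = 1 := by simp [unimod]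

lemma conj_unimod (j : ℤ) (x : ℝ) : (starRingEnd ℂ) (unimod j x) = unimod (-j) x := by
  rw [unimod, unimod, ← Complex.exp_conj]
  congr 1; simp

/-- Normalized Lebesgue measure on `[-π, π)`. -/
def circN : Measure ℝ := ENNReal.ofReal (1 / (2 * Real.pi)) • circ

lemma inv_two_pi_pos : 0 < 1 / (2 * Real.pi) := by positivity

lemma circ_univ : circ Set.univ = ENNReal.ofReal (2 * Real.pi) := by
  rw [circ, Measure.restrict_apply_univ, Real.volume_Ico]
  congr 1; ring

instance : IsFiniteMeasure circ := ⟨by rw [circ_univ]; exact ENNReal.ofReal_lt_top⟩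

instance : IsProbabilityMeasure circN := ⟨by
  rw [circN, Measure.smul_apply, circ_univ, smul_eq_mul,
    ← ENNReal.ofReal_mul inv_two_pi_pos.le]
  have := Real.pi_pos.ne'
  rw [show 1 / (2 * Real.pi) * (2 * Real.pi) = 1 by field_simp, ENNReal.ofReal_one]⟩

lemma ofReal_inv_two_pi_ne_zero : ENNReal.ofReal (1 / (2 * Real.pi)) ≠ 0 := by
  simp [Real.pi_pos]

lemma ae_circN : ae circN = ae circ :=
  Measure.ae_ennreal_smul_measure_eq ofReal_inv_two_pi_ne_zero circ

lemma aestronglyMeasurable_circN {F : Type*} [TopologicalSpace F] {f : ℝ → F} :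
    AEStronglyMeasurable f circN ↔ AEStronglyMeasurable f circ :=
  ⟨fun h => h.mono_ac (Measure.ae_le_iff_absolutelyContinuous.1 ae_circN.ge),
    fun h => h.smul_measure _⟩

lemma lintegral_circN (f : ℝ → ENNReal) :
    ∫⁻ x, f x ∂circN = ENNReal.ofReal (1 / (2 * Real.pi)) * ∫⁻ x, f x ∂circ := by
  rw [circN, lintegral_smul_measure, smul_eq_mul]

lemma integral_circN {F : Type*} [NormedAddCommGroup F] [NormedSpace ℝ F] [NormedSpace ℂ F]
    [IsScalarTower ℝ ℂ F] (f : ℝ → F) :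
    ∫ x, f x ∂circN = (1 / (2 * Real.pi) : ℂ) • ∫ x, f x ∂circ := by
  rw [circN, integral_smul_measure, ENNReal.toReal_ofReal inv_two_pi_pos.le,
    RCLike.real_smul_eq_coe_smul (K := ℂ)]
  simp

lemma integrable_circN {F : Type*} [NormedAddCommGroup F] {f : ℝ → F} :
    Integrable f circN ↔ Integrable f circ :=
  integrable_smul_measure ofReal_inv_two_pi_ne_zero ENNReal.ofReal_ne_top

lemma integral_circ_eq_zero_iff {F : Type*} [NormedAddCommGroup F] [NormedSpace ℝ F]
    [NormedSpace ℂ F] [IsScalarTower ℝ ℂ F] (f : ℝ → F) : ∫ x, f x ∂circ = 0 ↔ ∫ x, f x ∂circN = 0 := by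
  rw [integral_circN, smul_eq_zero, or_iff_right]
  have : (Real.pi : ℂ) ≠ 0 := by exact_mod_cast Real.pi_pos.ne'
  simp [this]

/-- Pairing with an integrable φ is a bounded functional on the continuous functions of the circle.
Its kernel is closed and contains the exponentials, whose span is dense. -/
lemma integral_unimod_smul_continuous_eq_zero {F : Type*} [NormedAddCommGroup F]
    [NormedSpace ℂ F] {φ : ℝ → F} (hφ : Integrable φ circ)
    (h : ∀ j : ℤ, ∫ x, unimod j x • φ x ∂circ = 0) (θ : C(AddCircle (2 * Real.pi), ℂ)) :
    ∫ x : ℝ, θ x • φ x ∂circ = 0 := by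
  have : Fact (0 < 2 * Real.pi) := ⟨by positivity⟩
  have hint : ∀ θ : C(AddCircle (2 * Real.pi), ℂ),
      Integrable (fun x : ℝ => θ x • φ x) circ := fun θ =>
    hφ.bdd_smul ‖θ‖ (by
      have : Continuous fun x : ℝ => θ (x : AddCircle (2 * Real.pi)) :=
        θ.continuous.comp (AddCircle.continuous_mk' _)
      exact this.aestronglyMeasurable) (.of_forall fun x => θ.norm_coe_le_norm _)
  let L : C(AddCircle (2 * Real.pi), ℂ) →L[ℂ] F := LinearMap.mkContinuous
    { toFun := fun θ => ∫ x : ℝ, θ x • φ x ∂circ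
      map_add' := fun θ η => by
        simp only [ContinuousMap.add_apply, add_smul]
        exact integral_add (hint θ) (hint η)
      map_smul' := fun c θ => by
        simp only [ContinuousMap.smul_apply, smul_assoc, RingHom.id_apply]
        exact integral_smul c _ } (∫ x, ‖φ x‖ ∂circ) (by
      intro θ
      refine (norm_integral_le_integral_norm _).trans ?_
      refine (integral_mono (hint θ).norm (hφ.norm.mul_const ‖θ‖) fun x => ?_).trans_eq
        (integral_mul_const _ _)
      simp only [norm_smul]
      rw [mul_comm]
      gcongr
      exact θ.norm_coe_le_norm _)
  have hL : (⊤ : Submodule ℂ C(AddCircle (2 * Real.pi), ℂ)) ≤ L.ker := by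
    rw [← span_fourier_closure_eq_top]
    refine Submodule.topologicalClosure_minimal _ ?_ L.isClosed_ker
    rw [Submodule.span_le]
    rintro _ ⟨n, rfl⟩
    show L (fourier n) = 0
    rw [← h n]
    refine integral_congr_ae (.of_forall fun x => ?_)
    show fourier n (x : AddCircle (2 * Real.pi)) • φ x = _
    rw [fourier_coe_apply]
    unfold unimod
    congr 2
    have : (Real.pi : ℂ) ≠ 0 := by exact_mod_cast Real.pi_pos.ne'
    push_cast
    field_simp
  exact hL (Submodule.mem_top (x := θ))

/-- A function in `L¹` whose Fourier coefficients vanish is zero almost everywhere. -/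
theorem ae_eq_zero_of_forall_integral_unimod {F : Type*} [NormedAddCommGroup F]
    [NormedSpace ℂ F] [CompleteSpace F] {φ : ℝ → F} (hφ : Integrable φ circ)
    (h : ∀ j : ℤ, ∫ x, unimod j x • φ x ∂circ = 0) : ∀ᵐ x ∂circ, φ x = 0 := by
  have : Fact (0 < 2 * Real.pi) := ⟨by positivity⟩
  -- Smooth test functions supported in the open interval vanish at both ends, hence descend to
  -- continuous functions on the circle. The remaining endpoint -π is a null set.
  have key : ∀ᵐ x ∂circ, x ∈ Set.Ioo (-Real.pi) Real.pi → φ x = 0 := by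
    refine isOpen_Ioo.ae_eq_zero_of_integral_contDiff_smul_eq_zero
      (hφ.locallyIntegrable.locallyIntegrableOn _) fun g hg _ hsupp => ?_
    have hzero : ∀ x, x ∉ Set.Ioo (-Real.pi) Real.pi → g x = 0 := fun x hx =>
      image_eq_zero_of_notMem_tsupport fun h' => hx (hsupp h')
    have hcont : Continuous (AddCircle.liftIco (2 * Real.pi) (-Real.pi)
        fun x => (g x : ℂ)) := by
      refine AddCircle.liftIco_continuous ?_ ?_
      · rw [hzero _ (by simp), hzero _ (by rw [Set.mem_Ioo]; intro h; linarith [h.2])]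
      · exact (Complex.continuous_ofReal.comp hg.continuous).continuousOn
    rw [← integral_unimod_smul_continuous_eq_zero hφ h ⟨_, hcont⟩]
    refine integral_congr_ae ?_
    filter_upwards [ae_restrict_mem measurableSet_Ico] with x hx
    have hx' : x ∈ Set.Ico (-Real.pi) (-Real.pi + 2 * Real.pi) := by
      rwa [show -Real.pi + 2 * Real.pi = Real.pi by ring]
    simp only [ContinuousMap.coe_mk]
    rw [AddCircle.liftIco_coe_apply hx', Complex.coe_smul]
  have hne : ∀ᵐ x ∂circ, x ≠ -Real.pi := by
    rw [circ]
    exact ae_restrict_of_ae (Measure.ae_ne volume _)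
  filter_upwards [key, hne, ae_restrict_mem (μ := volume) measurableSet_Ico] with x h1 h2 h3
  exact h1 ⟨lt_of_le_of_ne h3.1 h2.symm, h3.2⟩

lemma integral_unimod {j : ℤ} (hj : j ≠ 0) : ∫ x, unimod j x ∂circ = 0 := by
  have hj' : (j : ℂ) ≠ 0 := by exact_mod_cast hj
  rw [circ, integral_Ico_eq_integral_Ioc,
    ← intervalIntegral.integral_of_le (by linarith [Real.pi_pos])]
  have hc : Complex.I * j ≠ 0 := mul_ne_zero Complex.I_ne_zero hj'
  have := integral_exp_mul_complex (a := -Real.pi) (b := Real.pi) hc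
  have h2 : (fun x : ℝ => Complex.exp (Complex.I * j * x)) = unimod j := by
    funext x; rw [unimod]; congr 1; ring
  rw [h2] at this
  rw [this, div_eq_zero_iff]
  left
  rw [sub_eq_zero, Complex.exp_eq_exp_iff_exists_int]
  exact ⟨j, by push_cast; ring⟩

/-! ### Multiplication by `e^{ijx}` on `L²` -/

variable {E : Type*} [NormedAddCommGroup E] [InnerProductSpace ℂ E]

lemma memLp_unimod_smul (j : ℤ) {u : ℝ → E} (hu : MemLp u 2 circN) :
    MemLp (fun x => unimod j x • u x) 2 circN :=
  hu.of_le ((continuous_unimod j).aestronglyMeasurable.smul hu.1)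
    (.of_forall fun x => by simp [norm_smul])

/-- Multiplication by `e^{ijx}` as an isometry of `L²`. -/
def rot (j : ℤ) : Lp E 2 circN →ₗᵢ[ℂ] Lp E 2 circN where
  toFun u := (memLp_unimod_smul j (Lp.memLp u)).toLp _
  map_add' u v := by
    rw [← MemLp.toLp_add]
    refine MemLp.toLp_congr _ _ ?_
    filter_upwards [Lp.coeFn_add u v] with x hx
    rw [hx]
    exact smul_add _ _ _
  map_smul' c u := by
    rw [RingHom.id_apply, ← MemLp.toLp_const_smul]
    refine MemLp.toLp_congr _ _ ?_
    filter_upwards [Lp.coeFn_smul c u] with x hx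
    rw [hx]
    exact smul_comm _ _ _
  norm_map' u := by
    show ‖(memLp_unimod_smul j (Lp.memLp u)).toLp _‖ = ‖u‖
    rw [Lp.norm_toLp, Lp.norm_def]
    congr 1
    exact eLpNorm_congr_norm_ae (.of_forall fun x => by simp [norm_smul])

lemma coeFn_rot (j : ℤ) (u : Lp E 2 circN) :
    ∀ᵐ x ∂circN, rot j u x = unimod j x • u x :=
  MemLp.coeFn_toLp (memLp_unimod_smul j (Lp.memLp u))

lemma rot_rot (j k : ℤ) (u : Lp E 2 circN) : rot j (rot k u) = rot (j + k) u := by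
  refine Lp.ext ?_
  filter_upwards [coeFn_rot j (rot k u), coeFn_rot k u, coeFn_rot (j + k) u] with x h1 h2 h3
  rw [h1, h2, h3, unimod_add, mul_smul]

lemma rot_zero (u : Lp E 2 circN) : rot 0 u = u := by
  refine Lp.ext ?_
  filter_upwards [coeFn_rot 0 u] with x h1
  simp [h1]

lemma inner_rot_right (j : ℤ) (u v : Lp E 2 circN) :
    inner ℂ u (rot j v) = inner ℂ (rot (-j) u) v := by
  rw [← (rot (-j)).inner_map_map u (rot j v), rot_rot, neg_add_cancel, rot_zero]

/-- If the translates `e^{-ijx} Y`, `j ≥ 1`, are orthogonal to `Y`, then `‖Y(x)‖` is constant. -/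
lemma ae_norm_eq_of_inner_rot_eq_zero (Y : Lp E 2 circN)
    (h : ∀ n : ℕ, inner ℂ (rot (-((n : ℤ) + 1)) Y) Y = (0 : ℂ)) :
    ∀ᵐ x ∂circN, ‖Y x‖ = ‖Y‖ := by
  have hsq : Integrable (fun x => ‖Y x‖ ^ 2) circN := (Lp.memLp Y).integrable_norm_pow two_ne_zero
  have hsqC : Integrable (fun x => ((‖Y x‖ ^ 2 : ℝ) : ℂ)) circN := hsq.ofReal
  have hrot : ∀ j : ℤ, inner ℂ (rot (-j) Y) Y =
      ∫ x, unimod j x * ((‖Y x‖ ^ 2 : ℝ) : ℂ) ∂circN := by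
    intro j
    rw [L2.inner_def]
    refine integral_congr_ae ?_
    filter_upwards [coeFn_rot (-j) Y] with x hx
    rw [hx, inner_smul_left, conj_unimod, neg_neg, inner_self_eq_norm_sq_to_K]
    norm_cast
  have hcoef : ∀ j : ℤ, j ≠ 0 → ∫ x, unimod j x * ((‖Y x‖ ^ 2 : ℝ) : ℂ) ∂circN = 0 := by
    intro j hj
    rw [← hrot]
    rcases lt_or_gt_of_ne hj with hj | hj
    -- The hypothesis covers one sign of the frequency only; the other follows by conjugate
    -- symmetry.
    · have e : (((-j).toNat - 1 : ℕ) : ℤ) + 1 = -j := by omega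
      have := h ((-j).toNat - 1)
      rw [e, neg_neg] at this
      rw [← inner_conj_symm, inner_rot_right, neg_neg, this, map_zero]
    · have e : ((j.toNat - 1 : ℕ) : ℤ) + 1 = j := by omega
      have := h (j.toNat - 1)
      rwa [e] at this
  have hnorm : ((‖Y‖ ^ 2 : ℝ) : ℂ) = ∫ x, ((‖Y x‖ ^ 2 : ℝ) : ℂ) ∂circN := by
    have := hrot 0
    simp only [neg_zero, rot_zero, unimod_zero, one_mul] at this
    rw [← this, inner_self_eq_norm_sq_to_K]
    norm_cast
  have hφ : Integrable (fun x => ((‖Y x‖ ^ 2 : ℝ) : ℂ) - ((‖Y‖ ^ 2 : ℝ) : ℂ)) circN :=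
    hsqC.sub (integrable_const _)
  have hz := ae_eq_zero_of_forall_integral_unimod (integrable_circN.1 hφ) (fun j => by
    rw [integral_circ_eq_zero_iff]
    simp only [smul_eq_mul, mul_sub]
    have i1 : Integrable (fun x => unimod j x * ((‖Y x‖ ^ 2 : ℝ) : ℂ)) circN :=
      hsqC.bdd_mul (c := 1) (continuous_unimod j).aestronglyMeasurable (.of_forall fun x => by simp)
    have i2 : Integrable (fun x => unimod j x * ((‖Y‖ ^ 2 : ℝ) : ℂ)) circN :=
      (integrable_const _).bdd_mul (c := 1) (continuous_unimod j).aestronglyMeasurable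
        (.of_forall fun x => by simp)
    rw [integral_sub i1 i2, integral_mul_const]
    by_cases hj : j = 0
    · subst hj
      simp [hnorm]
    · rw [hcoef j hj, (integral_circ_eq_zero_iff _).1 (integral_unimod hj)]
      simp)
  rw [ae_circN]
  filter_upwards [hz] with x hx
  have : ‖Y x‖ ^ 2 = ‖Y‖ ^ 2 := by
    rw [sub_eq_zero] at hx
    exact_mod_cast hx
  exact (sq_eq_sq₀ (norm_nonneg _) (norm_nonneg _)).1 this

/-! ### Essential boundedness of prediction errors -/

lemma rot_neg_mem {N : Submodule ℂ (Lp E 2 circN)} (hN : ∀ u ∈ N, rot (-1) u ∈ N)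
    {Y : Lp E 2 circN} (hY : rot (-1) Y ∈ N) (n : ℕ) : rot (-((n : ℤ) + 1)) Y ∈ N := by
  induction n with
  | zero => simpa using hY
  | succ n ih =>
    have := hN _ ih
    rw [rot_rot] at this
    convert this using 2
    push_cast; ring_nf

/-- Since z is one step ahead of N, the error Y = z - P_N z has all its translates e^{-inx}Y, n ≥ 1,
in N, while Y itself is orthogonal to N. So ‖Y(x)‖ is constant, equal to ‖Y‖, which is at most ‖z‖.
-/
lemma ae_norm_sub_starProjection_le {N : Submodule ℂ (Lp E 2 circN)} [N.HasOrthogonalProjection]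
    (hN : ∀ u ∈ N, rot (-1) u ∈ N) {z : Lp E 2 circN} (hz : rot (-1) z ∈ N) :
    ∀ᵐ x ∂circN, ‖(z - N.starProjection z : Lp E 2 circN) x‖ ≤ ‖z‖ := by
  have hY : rot (-1) (z - N.starProjection z) ∈ N := by
    rw [map_sub]
    exact N.sub_mem hz (hN _ (N.starProjection_apply_mem z))
  have horth := N.sub_starProjection_mem_orthogonal z
  have hle : ‖z - N.starProjection z‖ ≤ ‖z‖ := by
    have h1 := N.norm_sq_eq_add_norm_sq_starProjection z
    have h2 : Nᗮ.starProjection z = z - N.starProjection z := by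
      rw [Submodule.starProjection_orthogonal]; rfl
    rw [h2] at h1
    nlinarith [norm_nonneg z, norm_nonneg (z - N.starProjection z), norm_nonneg (N.starProjection z)]
  filter_upwards [ae_norm_eq_of_inner_rot_eq_zero _ fun n =>
    (N.mem_orthogonal _).1 horth _ (rot_neg_mem hN hY n)] with x hx
  rw [hx]; exact hle

/-- The prediction error at distance `j` is essentially bounded by `(j + 1) ‖y‖`. -/
theorem ae_norm_rot_sub_starProjection_le {N : Submodule ℂ (Lp E 2 circN)}
    [N.HasOrthogonalProjection] (hN : ∀ u ∈ N, rot (-1) u ∈ N) {y : Lp E 2 circN}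
    (hy : rot (-1) y ∈ N) (j : ℕ) :
    ∀ᵐ x ∂circN, ‖(rot j y - N.starProjection (rot j y) : Lp E 2 circN) x‖ ≤ (j + 1) * ‖y‖ := by
  induction j with
  | zero => simpa [rot_zero] using ae_norm_sub_starProjection_le hN hy
  | succ j ih =>
    set X := rot j y - N.starProjection (rot j y) with hX
    -- Shifting the decomposition of e^{ijx}y by one step, the projected part z is one step ahead of
    -- N, and the old error X stays orthogonal to N after the shift because N is stable under
    -- e^{-ix}. The new error is thus the one-step error of z, of size at most ‖y‖, plus the shifted
    -- X.
    set z := rot 1 (N.starProjection (rot j y)) with hz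
    have hzN : rot (-1) z ∈ N := by
      rw [hz, rot_rot, neg_add_cancel, rot_zero]
      exact N.starProjection_apply_mem _
    have hXorth : rot 1 X ∈ Nᗮ := by
      rw [Submodule.mem_orthogonal]
      intro w hw
      rw [inner_rot_right]
      exact (N.mem_orthogonal _).1 (N.sub_starProjection_mem_orthogonal _) _ (hN w hw)
    have hsum : rot ((j + 1 : ℕ) : ℤ) y = z + rot 1 X := by
      rw [hz, hX, ← map_add, add_sub_cancel, rot_rot]
      congr 2; push_cast; ring
    have hdec : rot ((j + 1 : ℕ) : ℤ) y - N.starProjection (rot ((j + 1 : ℕ) : ℤ) y) =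
        (z - N.starProjection z) + rot 1 X := by
      rw [hsum, map_add, (N.starProjection_apply_eq_zero_iff).2 hXorth]
      abel
    have hznorm : ‖z‖ ≤ ‖y‖ := by
      rw [hz, LinearIsometry.norm_map]
      refine (N.norm_starProjection_apply_le _).trans ?_
      rw [LinearIsometry.norm_map]
    rw [hdec]
    filter_upwards [ih, ae_norm_sub_starProjection_le hN hzN, coeFn_rot 1 X,
      Lp.coeFn_add (z - N.starProjection z) (rot 1 X)] with x h1 h2 h3 h4
    rw [h4, Pi.add_apply, h3]
    refine (norm_add_le _ _).trans ?_
    rw [norm_smul, norm_unimod, one_mul]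
    rw [Nat.cast_add, Nat.cast_one]
    linarith

end

section

/-! ### Square roots of positive operators -/

section Sqrt

variable {E : Type*} [NormedAddCommGroup E] [InnerProductSpace ℂ E]

lemma clm_mul_apply (S S' : E →L[ℂ] E) (v : E) : (S * S') v = S (S' v) := rfl

variable [CompleteSpace E]

/-- The positive square root of a positive operator. -/
def opSqrt (S : E →L[ℂ] E) : E →L[ℂ] E := CFC.sqrt S

lemma adjoint_opSqrt (S : E →L[ℂ] E) : ContinuousLinearMap.adjoint (opSqrt S) = opSqrt S :=
  (IsSelfAdjoint.of_nonneg (CFC.sqrt_nonneg S)).star_eq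

lemma opSqrt_mul_self {S : E →L[ℂ] E} (hS : S.IsPositive) : opSqrt S * opSqrt S = S :=
  CFC.sqrt_mul_sqrt_self _ ((ContinuousLinearMap.nonneg_iff_isPositive _).2 hS)

/-- The square root is continuous on the closed cone of positive operators; extending it by zero off
the cone gives a Borel function. -/
lemma exists_measurable_eq_opSqrt [MeasurableSpace (E →L[ℂ] E)] [BorelSpace (E →L[ℂ] E)] :
    ∃ g : (E →L[ℂ] E) → (E →L[ℂ] E), Measurable g ∧ ∀ S, S.IsPositive → g S = opSqrt S := by
  classical
  refine ⟨{a : E →L[ℂ] E | 0 ≤ a}.piecewise CFC.sqrt 0,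
    ContinuousOn.measurable_piecewise CFC.continuousOn_sqrt continuousOn_const
      CStarAlgebra.isClosed_nonneg.measurableSet, fun S hS => ?_⟩
  exact Set.piecewise_eq_of_mem {a : E →L[ℂ] E | 0 ≤ a} _ _
    ((ContinuousLinearMap.nonneg_iff_isPositive _).2 hS)

lemma isUnit_of_isPositive_sub {S S' : E →L[ℂ] E} (hS : S.IsPositive) (hu : IsUnit S)
    (h : (S' - S).IsPositive) : IsUnit S' :=
  CStarAlgebra.isUnit_of_le S ((ContinuousLinearMap.le_def _ _).2 h)
    ⟨(ContinuousLinearMap.nonneg_iff_isPositive _).2 hS, hu⟩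

/-- Inversion reverses the operator order. This keeps the integral in the minimality condition
finite for mixtures. -/
lemma isPositive_inverse_sub_inverse {S S' : E →L[ℂ] E} (hS : S.IsPositive) (hu : IsUnit S)
    (h : (S' - S).IsPositive) : (Ring.inverse S - Ring.inverse S').IsPositive := by
  have hS0 : IsStrictlyPositive S := ⟨(ContinuousLinearMap.nonneg_iff_isPositive _).2 hS, hu⟩
  have hle : S ≤ S' := (ContinuousLinearMap.le_def _ _).2 h
  exact (ContinuousLinearMap.le_def _ _).1
    (CStarAlgebra.antitoneOn_ringInverse hS0 (hS0.of_le hle) hle)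

end Sqrt

/-! ### The factor `χ` and the weight -/

lemma measurable_chi (τ d : ℕ) : Measurable (chi τ d) := by
  unfold chi; fun_prop

/-- All exceptional points, including 0, lie in the countable set (2π/τ)ℤ. -/
lemma ae_ne_zero_of_pos {τ : ℕ} (hτ : 0 < τ) :
    ∀ᵐ x : ℝ ∂circ, ((x : ℝ) : ℂ) ≠ 0 ∧ 1 - Complex.exp (-(Complex.I * x * τ)) ≠ 0 := by
  have hc : (Set.range fun n : ℤ => -(2 * Real.pi * n / τ)).Countable := Set.countable_range _
  have h1 : ∀ᵐ x ∂circ, x ∉ Set.range fun n : ℤ => -(2 * Real.pi * n / τ) := by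
    rw [circ]
    exact ae_restrict_of_ae (hc.ae_notMem _)
  filter_upwards [h1] with x hx
  have hτ' : (τ : ℝ) ≠ 0 := by exact_mod_cast hτ.ne'
  refine ⟨fun h => hx ⟨0, ?_⟩, fun h => hx ?_⟩
  · have : x = 0 := by exact_mod_cast h
    simp [this]
  · rw [sub_eq_zero, eq_comm, Complex.exp_eq_one_iff] at h
    obtain ⟨n, hn⟩ := h
    refine ⟨n, ?_⟩
    have h2 : ((-(x * τ) : ℝ) : ℂ) * Complex.I = ((n * (2 * Real.pi) : ℝ) : ℂ) * Complex.I := by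
      push_cast
      linear_combination hn
    have h3 := mul_right_cancel₀ Complex.I_ne_zero h2
    have h4 : -(x * τ) = n * (2 * Real.pi) := by exact_mod_cast h3
    simp only
    field_simp
    linarith

lemma ae_chi_ne_zero {τ : ℕ} (d : ℕ) (hτ : 0 < τ) : ∀ᵐ x ∂circ, chi τ d x ≠ 0 := by
  filter_upwards [ae_ne_zero_of_pos hτ] with x hx
  exact div_ne_zero (pow_ne_zero _ hx.2) (pow_ne_zero _ (mul_ne_zero Complex.I_ne_zero hx.1))

lemma conj_one_sub_exp (τ : ℕ) (x : ℝ) :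
    (starRingEnd ℂ) (1 - Complex.exp (-(Complex.I * x * τ))) =
      1 - Complex.exp (Complex.I * x * τ) := by
  rw [map_sub, map_one, ← Complex.exp_conj]
  congr 2
  simp

lemma conj_chi (τ d : ℕ) (x : ℝ) : (starRingEnd ℂ) (chi τ d x) =
    (1 - Complex.exp (Complex.I * x * τ)) ^ d / (-(Complex.I * x)) ^ d := by
  rw [chi, map_div₀, map_pow, map_pow, conj_one_sub_exp]
  simp

lemma inv_conj_chi (τ d : ℕ) (x : ℝ) : ((starRingEnd ℂ) (chi τ d x))⁻¹ =
    (-(Complex.I * x)) ^ d / (1 - Complex.exp (Complex.I * x * τ)) ^ d := by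
  rw [conj_chi, inv_div]

lemma weight_eq (τ d : ℕ) (x : ℝ) : weight τ d x = (‖chi τ d x‖ ^ 2)⁻¹ := by
  rw [← Complex.norm_conj (chi τ d x), conj_chi, weight, norm_div, norm_pow, norm_pow, norm_neg,
    norm_mul, Complex.norm_I, one_mul, Complex.norm_real, div_pow, inv_div, Real.norm_eq_abs]
  congr 1
  · rw [← pow_mul, mul_comm d 2, Even.pow_abs ⟨d, by ring⟩]
  · rw [← pow_mul, mul_comm d 2]

lemma weight_eq_complex (τ d : ℕ) (x : ℝ) :
    (weight τ d x : ℂ) = (chi τ d x)⁻¹ * ((starRingEnd ℂ) (chi τ d x))⁻¹ := by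
  rw [weight_eq, ← mul_inv, Complex.mul_conj, Complex.normSq_eq_norm_sq]
  push_cast; rfl

/-! ### The coordinate space -/

variable {K : Set ℕ+}

lemma inner_basisVec (k : K) (v : Vec K) : inner ℂ (basisVec k) v = v k := by
  rw [basisVec, lp.inner_single_left]
  simp

lemma norm_basisVec (k : K) : ‖basisVec k‖ = 1 := by
  have h := inner_basisVec k (basisVec k)
  rw [inner_self_eq_norm_sq_to_K, basisVec, lp.single_apply_self, ← basisVec] at h
  have h2 : ‖basisVec k‖ ^ 2 = 1 := Complex.ofReal_injective (by push_cast; exact h)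
  nlinarith [norm_nonneg (basisVec k)]

lemma finiteDimensional_vec [Finite K] : FiniteDimensional ℂ (Vec K) := by
  have := Fintype.ofFinite K
  exact (lpPiLpₗᵢ (fun _ : K => ℂ) ℂ (p := 2)).symm.toLinearEquiv.finiteDimensional

lemma sum_smul_basisVec [Fintype K] (v : Vec K) : ∑ k : K, v k • basisVec k = v := by
  ext n
  rw [← inner_basisVec, inner_sum, Finset.sum_eq_single n]
  · rw [inner_smul_right, inner_basisVec, basisVec, lp.single_apply_self, mul_one]
  · intro k _ hk
    rw [inner_smul_right, inner_basisVec, basisVec, lp.single_apply_ne _ _ _ hk.symm, mul_zero]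
  · simp

lemma norm_sq_eq_sum [Fintype K] (v : Vec K) : ‖v‖ ^ 2 = ∑ k : K, ‖v k‖ ^ 2 := by
  have := lp.norm_rpow_eq_tsum (p := 2) (by norm_num) v
  simpa using this

lemma measurable_ringInverse {A : Type*} [NormedRing A] [CompleteSpace A] [MeasurableSpace A]
    [BorelSpace A] : Measurable (Ring.inverse : A → A) := by
  classical
  have h : (Ring.inverse : A → A) = {a | IsUnit a}.piecewise Ring.inverse 0 := by
    funext a
    by_cases ha : IsUnit a
    · exact (Set.piecewise_eq_of_mem {a : A | IsUnit a} _ _ ha).symm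
    · rw [Set.piecewise_eq_of_notMem {a : A | IsUnit a} _ _ ha, Ring.inverse_non_unit _ ha]; rfl
  rw [h]
  refine ContinuousOn.measurable_piecewise ?_ continuousOn_const Units.isOpen.measurableSet
  rintro _ ⟨u, rfl⟩
  exact (NormedRing.inverse_continuousAt u).continuousWithinAt

/-! ### Spectral densities on a finite set of components -/

section Density

variable {τ d : ℕ} {f : ℝ → Vec K →L[ℂ] Vec K}

/-- With finitely many coordinates an operator is a finite sum of rank-one operators built from its
columns, so weak measurability gives measurability in norm. -/
lemma aestronglyMeasurable_clm [Finite K] {μ : Measure ℝ}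
    (hf : ∀ v : Vec K, AEStronglyMeasurable (fun x => f x v) μ) : AEStronglyMeasurable f μ := by
  have := Fintype.ofFinite K
  have h : f = fun x => ∑ k : K, (innerSL ℂ (basisVec k)).smulRight (f x (basisVec k)) := by
    funext x
    ext1 v
    conv_lhs => rw [← sum_smul_basisVec v, map_sum]
    rw [sum_apply]
    refine Finset.sum_congr rfl fun k _ => ?_
    rw [map_smul, ContinuousLinearMap.smulRight_apply, innerSL_apply_apply, inner_basisVec]
  rw [h]
  refine Finset.aestronglyMeasurable_fun_sum _ fun k _ => ?_
  exact (ContinuousLinearMap.smulRightL ℂ (Vec K) (Vec K)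
    (innerSL ℂ (basisVec k))).continuous.comp_aestronglyMeasurable (hf (basisVec k))

lemma aestronglyMeasurable_apply {μ : Measure ℝ} {g : ℝ → Vec K →L[ℂ] Vec K} {u : ℝ → Vec K}
    (hg : AEStronglyMeasurable g μ) (hu : AEStronglyMeasurable u μ) :
    AEStronglyMeasurable (fun x => g x (u x)) μ :=
  isBoundedBilinearMap_apply.continuous.comp_aestronglyMeasurable (hg.prodMk hu)

/-- The square root of a spectral density. -/
def sqrtDensity (f : ℝ → Vec K →L[ℂ] Vec K) (x : ℝ) : Vec K →L[ℂ] Vec K := opSqrt (f x)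

lemma adjoint_sqrtDensity (f : ℝ → Vec K →L[ℂ] Vec K) (x : ℝ) :
    ContinuousLinearMap.adjoint (sqrtDensity f x) = sqrtDensity f x :=
  adjoint_opSqrt _

lemma sqrtDensity_mul_self {x : ℝ} (hx : (f x).IsPositive) :
    sqrtDensity f x * sqrtDensity f x = f x :=
  opSqrt_mul_self hx

lemma inner_apply_eq {x : ℝ} (hx : (f x).IsPositive) (u v : Vec K) :
    inner ℂ u (f x v) = inner ℂ (sqrtDensity f x u) (sqrtDensity f x v) := by
  conv_lhs => rw [← sqrtDensity_mul_self hx]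
  rw [clm_mul_apply, ← ContinuousLinearMap.adjoint_inner_left, adjoint_sqrtDensity]

lemma re_inner_apply_self {x : ℝ} (hx : (f x).IsPositive) (v : Vec K) :
    (inner ℂ v (f x v)).re = ‖sqrtDensity f x v‖ ^ 2 := by
  rw [inner_apply_eq hx, inner_self_eq_norm_sq_to_K]
  norm_cast

lemma ofReal_inner_apply_self {x : ℝ} (hx : (f x).IsPositive) (v : Vec K) :
    ENNReal.ofReal (inner ℂ v (f x v)).re = ‖sqrtDensity f x v‖ₑ ^ 2 := by
  rw [re_inner_apply_self hx, ENNReal.ofReal_pow (norm_nonneg _), ofReal_norm]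

lemma isUnit_sqrtDensity {x : ℝ} (hx : (f x).IsPositive) (hu : IsUnit (f x)) :
    IsUnit (sqrtDensity f x) := by
  rw [← sqrtDensity_mul_self hx] at hu
  exact ((Commute.refl _).isUnit_mul_iff.1 hu).1

lemma trace_eq {x : ℝ} (hx : (f x).IsPositive) :
    trace (f x) = ∑' k : K, ‖sqrtDensity f x (basisVec k)‖ₑ ^ 2 :=
  tsum_congr fun _ => ofReal_inner_apply_self hx _

lemma aestronglyMeasurable_sqrtDensity [Finite K] (hf : IsSpectralDensity τ d f) :
    AEStronglyMeasurable (sqrtDensity f) circ := by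
  have := finiteDimensional_vec (K := K)
  have : FiniteDimensional ℂ (Vec K →L[ℂ] Vec K) := inferInstance
  have : ProperSpace (Vec K →L[ℂ] Vec K) := FiniteDimensional.proper ℂ _
  borelize (Vec K →L[ℂ] Vec K)
  have hm : AEMeasurable f circ := (aestronglyMeasurable_clm hf.measurable).aemeasurable
  obtain ⟨g, hg, hgs⟩ := exists_measurable_eq_opSqrt (E := Vec K)
  refine ((hg.comp_aemeasurable hm).congr ?_).aestronglyMeasurable
  filter_upwards [hf.positive] with x hx
  exact hgs _ hx

/-- The trace of f is the squared Hilbert–Schmidt norm of f^{1/2}, so this is the Cauchy–Schwarz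
inequality over the coordinates. -/
lemma enorm_sqrtDensity_apply_sq_le [Finite K] {x : ℝ} (hx : (f x).IsPositive) (v : Vec K) :
    ‖sqrtDensity f x v‖ₑ ^ 2 ≤ trace (f x) * ‖v‖ₑ ^ 2 := by
  have := Fintype.ofFinite K
  have h : ‖sqrtDensity f x v‖ ^ 2 ≤
      (∑ k : K, ‖sqrtDensity f x (basisVec k)‖ ^ 2) * ‖v‖ ^ 2 := by
    rw [norm_sq_eq_sum v]
    have h1 : ‖sqrtDensity f x v‖ ≤ ∑ k : K, ‖sqrtDensity f x (basisVec k)‖ * ‖v k‖ := by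
      conv_lhs => rw [← sum_smul_basisVec v, map_sum]
      refine (norm_sum_le _ _).trans (Finset.sum_le_sum fun k _ => ?_)
      rw [map_smul, norm_smul, mul_comm]
    refine (pow_le_pow_left₀ (norm_nonneg _) h1 2).trans ?_
    exact Finset.sum_mul_sq_le_sq_mul_sq _ _ _
  rw [trace_eq hx, tsum_fintype]
  simp only [← ofReal_norm, ← ENNReal.ofReal_pow (norm_nonneg _)]
  rw [← ENNReal.ofReal_sum_of_nonneg fun _ _ => by positivity,
    ← ENNReal.ofReal_mul (Finset.sum_nonneg fun _ _ => by positivity)]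
  exact ENNReal.ofReal_le_ofReal h

lemma enorm_sqrtDensity_sq_le [Finite K] {x : ℝ} (hx : (f x).IsPositive) :
    ‖sqrtDensity f x‖ₑ ^ 2 ≤ trace (f x) := by
  by_cases ht : trace (f x) = ⊤
  · rw [ht]; exact le_top
  rw [← ENNReal.ofReal_toReal ht, ← ofReal_norm, ← ENNReal.ofReal_pow (norm_nonneg _)]
  refine ENNReal.ofReal_le_ofReal ?_
  rw [← Real.le_sqrt (norm_nonneg _) ENNReal.toReal_nonneg]
  refine ContinuousLinearMap.opNorm_le_bound _ (Real.sqrt_nonneg _) fun v => ?_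
  have h := enorm_sqrtDensity_apply_sq_le hx v
  rw [← ENNReal.ofReal_toReal ht, ← ofReal_norm, ← ofReal_norm,
    ← ENNReal.ofReal_pow (norm_nonneg _), ← ENNReal.ofReal_pow (norm_nonneg _),
    ← ENNReal.ofReal_mul ENNReal.toReal_nonneg, ENNReal.ofReal_le_ofReal_iff (by positivity)] at h
  rw [← Real.sqrt_sq (norm_nonneg v), ← Real.sqrt_mul ENNReal.toReal_nonneg]
  exact Real.le_sqrt_of_sq_le h

/-- The square root of the spectral density of the increments, `R = χ f^{1/2}`. -/
def rootSymbol (τ d : ℕ) (f : ℝ → Vec K →L[ℂ] Vec K) (x : ℝ) : Vec K →L[ℂ] Vec K :=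
  chi τ d x • sqrtDensity f x

/-- Pointwise ‖R‖² ≤ |χ|² Tr f, and the integral of the right side is finite by the definition of a
spectral density. -/
lemma memLp_rootSymbol [Finite K] (hf : IsSpectralDensity τ d f) :
    MemLp (rootSymbol τ d f) 2 circN := by
  refine ⟨aestronglyMeasurable_circN.2 ((measurable_chi τ d).aestronglyMeasurable.smul
    (aestronglyMeasurable_sqrtDensity hf)), ?_⟩
  rw [eLpNorm_lt_top_iff_lintegral_rpow_enorm_lt_top (by norm_num) (by norm_num)]
  rw [lintegral_circN]
  refine ENNReal.mul_lt_top ENNReal.ofReal_lt_top (lt_of_le_of_lt (lintegral_mono_ae ?_) hf.kernel)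
  filter_upwards [hf.positive] with x hx
  simp only [rootSymbol, enorm_smul, ENNReal.toReal_ofNat, ENNReal.rpow_ofNat, mul_pow]
  rw [← ofReal_norm (chi τ d x), ← ENNReal.ofReal_pow (norm_nonneg _)]
  gcongr
  exact enorm_sqrtDensity_sq_le hx

/-- Multiplication by f^{1/2} preserves norms, which lets the whole prediction problem be moved from
L_2(f) to an unweighted L². -/
lemma sqNorm_eq (hf : ∀ᵐ x ∂circ, (f x).IsPositive) (g : ℝ → Vec K) :
    sqNorm f g = ∫⁻ x, ‖sqrtDensity f x (g x)‖ₑ ^ 2 ∂circN := by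
  rw [sqNorm, lintegral_circN]
  congr 1
  refine lintegral_congr_ae ?_
  filter_upwards [hf] with x hx
  exact ofReal_inner_apply_self hx _

lemma trace_lt_top_ae (hτ : 0 < τ) (hf : IsSpectralDensity τ d f)
    (hK : AEMeasurable (fun x => ENNReal.ofReal (‖chi τ d x‖ ^ 2) * trace (f x)) circ) :
    ∀ᵐ x ∂circ, trace (f x) < ⊤ := by
  filter_upwards [ae_lt_top' hK hf.kernel.ne, ae_chi_ne_zero d hτ] with x hx hχ
  by_contra h
  rw [not_lt_top_iff] at h
  rw [h, ENNReal.mul_top (by simpa using hχ)] at hx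
  exact lt_irrefl _ hx

lemma aemeasurable_trace (hf : IsSpectralDensity τ d f) :
    AEMeasurable (fun x => trace (f x)) circ := by
  refine AEMeasurable.tsum fun k => ?_
  exact ((Complex.measurable_re.comp_aemeasurable
    (aestronglyMeasurable_const.inner (hf.measurable (basisVec k))).aemeasurable)).ennreal_ofReal

/-- The minimality condition can only hold if finitely many components are present. -/
theorem finite_of_minimality (hτ : 0 < τ) (hf : IsSpectralDensity τ d f)
    (hmin : Minimality τ d f) : Finite K := by
  have hne : (ae circ).NeBot := by
    rw [ae_neBot]
    intro h
    have := circ_univ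
    rw [h] at this
    simp at this
    linarith [Real.pi_pos]
  have hm : AEMeasurable (fun x => ENNReal.ofReal (‖chi τ d x‖ ^ 2) * trace (f x)) circ :=
    ((measurable_chi τ d).norm.pow_const 2).ennreal_ofReal.aemeasurable.mul (aemeasurable_trace hf)
  obtain ⟨x, hx, hpos, hu⟩ :=
    ((trace_lt_top_ae hτ hf hm).and (hf.positive.and hmin.1)).exists
  obtain ⟨u, hu⟩ := isUnit_sqrtDensity hpos hu
  -- An invertible square root is bounded below on unit vectors, so each diagonal term of the trace
  -- exceeds one positive constant. Infinitely many such terms would contradict the finite trace.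
  have hle : ∀ k : K, (‖(↑u⁻¹ : Vec K →L[ℂ] Vec K)‖ₑ ^ 2)⁻¹ ≤
      ‖sqrtDensity f x (basisVec k)‖ₑ ^ 2 := by
    intro k
    rw [ENNReal.inv_le_iff_le_mul (fun h => by simp at h) (fun h => by simp at h), ← mul_pow]
    have h1 : (↑u⁻¹ : Vec K →L[ℂ] Vec K) (sqrtDensity f x (basisVec k)) = basisVec k := by
      rw [← hu, ← clm_mul_apply, Units.inv_mul]; rfl
    have h2 := (↑u⁻¹ : Vec K →L[ℂ] Vec K).le_opENorm (sqrtDensity f x (basisVec k))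
    rw [h1, ← ofReal_norm (basisVec k), norm_basisVec, ENNReal.ofReal_one] at h2
    exact one_le_pow₀ h2
  by_contra hK
  rw [not_finite_iff_infinite] at hK
  rw [trace_eq hpos] at hx
  refine hx.ne (top_unique ?_)
  refine le_trans ?_ (ENNReal.tsum_le_tsum hle)
  rw [ENNReal.tsum_const_eq_top_of_ne_zero]
  simp

end Density

end

section

variable {K : Set ℕ+} {τ d : ℕ} {f : ℝ → Vec K →L[ℂ] Vec K}

/-! ### The function `B` -/

lemma exp_natCast_eq_unimod (x : ℝ) (j : ℕ) : Complex.exp (Complex.I * x * j) = unimod j x := by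
  simp [unimod]

lemma exp_natCast_add_one_eq_unimod (x : ℝ) (j : ℕ) :
    Complex.exp (Complex.I * x * ((j : ℂ) + 1)) = unimod (j + 1) x := by
  simp [unimod]

lemma exp_neg_natCast_eq_unimod (x : ℝ) (j : ℕ) :
    Complex.exp (-(Complex.I * x * j)) = unimod (-j) x := by
  simp [unimod]

lemma exp_neg_natCast_add_one_eq_unimod (x : ℝ) (j : ℕ) :
    Complex.exp (-(Complex.I * x * ((j : ℂ) + 1))) = unimod (-((j : ℤ) + 1)) x := by
  simp only [unimod]
  congr 1; push_cast; ring

/-- The partial sums of `B`. -/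
def partialB (b : ℕ → Vec K) (n : ℕ) (x : ℝ) : Vec K := ∑ j ∈ Finset.range n, unimod j x • b j

lemma Bfun_eq (b : ℕ → Vec K) (x : ℝ) : Bfun b x = ∑' j : ℕ, unimod j x • b j :=
  tsum_congr fun j => by rw [exp_natCast_eq_unimod]

lemma norm_unimod_smul (j : ℤ) (x : ℝ) (v : Vec K) : ‖unimod j x • v‖ = ‖v‖ := by
  rw [norm_smul, norm_unimod, one_mul]

lemma aestronglyMeasurable_unimod_smul (j : ℤ) (v : Vec K) :
    AEStronglyMeasurable (fun x => unimod j x • v) circN :=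
  ((continuous_unimod j).smul continuous_const).aestronglyMeasurable

lemma summable_unimod_smul {b : ℕ → Vec K} (hb : Summable fun j => ‖b j‖) (x : ℝ) :
    Summable fun j : ℕ => unimod j x • b j :=
  Summable.of_norm (by simpa only [norm_unimod_smul] using hb)

lemma continuous_Bfun {b : ℕ → Vec K} (hb : Summable fun j => ‖b j‖) : Continuous (Bfun b) := by
  rw [show Bfun b = fun x => ∑' j : ℕ, unimod j x • b j from funext (Bfun_eq b)]
  exact continuous_tsum (fun j => (continuous_unimod j).smul continuous_const) hb
    fun j x => (norm_unimod_smul _ _ _).le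

lemma norm_Bfun_le {b : ℕ → Vec K} (hb : Summable fun j => ‖b j‖) (x : ℝ) :
    ‖Bfun b x‖ ≤ ∑' j, ‖b j‖ := by
  rw [Bfun_eq]
  exact tsum_of_norm_bounded hb.hasSum fun j => (norm_unimod_smul _ _ _).le

lemma continuous_partialB (b : ℕ → Vec K) (n : ℕ) : Continuous (partialB b n) :=
  continuous_finsetSum _ fun j _ => (continuous_unimod j).smul continuous_const

lemma norm_Bfun_sub_partialB_le {b : ℕ → Vec K} (hb : Summable fun j => ‖b j‖) (n : ℕ) (x : ℝ) :
    ‖Bfun b x - partialB b n x‖ ≤ ∑' j, ‖b (j + n)‖ := by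
  rw [Bfun_eq, ← (summable_unimod_smul hb x).sum_add_tsum_nat_add n, partialB, add_sub_cancel_left]
  exact tsum_of_norm_bounded ((summable_nat_add_iff n).2 hb).hasSum
    fun j => (norm_unimod_smul _ _ _).le

/-! ### The space of the past in `L²` -/

variable [Finite K]

lemma aestronglyMeasurable_rootSymbol_apply (hf : IsSpectralDensity τ d f) {φ : ℝ → Vec K}
    (hφ : AEStronglyMeasurable φ circN) :
    AEStronglyMeasurable (fun x => rootSymbol τ d f x (φ x)) circN :=
  aestronglyMeasurable_apply (memLp_rootSymbol hf).1 hφ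

lemma memLp_rootSymbol_apply (hf : IsSpectralDensity τ d f) {φ : ℝ → Vec K}
    (hφ : AEStronglyMeasurable φ circN) {c : ℝ} (hc : ∀ x, ‖φ x‖ ≤ c) :
    MemLp (fun x => rootSymbol τ d f x (φ x)) 2 circN :=
  (memLp_rootSymbol hf).of_le_mul (c := c) (aestronglyMeasurable_rootSymbol_apply hf hφ)
    (.of_forall fun x => by
      rw [mul_comm]
      exact (ContinuousLinearMap.le_opNorm _ _).trans (by gcongr; exact hc x))

/-- The element `R φ` of `L²`, for a bounded function `φ`. -/
def symLp (hf : IsSpectralDensity τ d f) {φ : ℝ → Vec K}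
    (hφ : AEStronglyMeasurable φ circN) {c : ℝ} (hc : ∀ x, ‖φ x‖ ≤ c) : Lp (Vec K) 2 circN :=
  (memLp_rootSymbol_apply hf hφ hc).toLp _

lemma coeFn_symLp (hf : IsSpectralDensity τ d f) {φ : ℝ → Vec K}
    (hφ : AEStronglyMeasurable φ circN) {c : ℝ} (hc : ∀ x, ‖φ x‖ ≤ c) :
    ∀ᵐ x ∂circN, symLp hf hφ hc x = rootSymbol τ d f x (φ x) :=
  MemLp.coeFn_toLp _

lemma norm_symLp_le (hf : IsSpectralDensity τ d f) {φ : ℝ → Vec K}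
    (hφ : AEStronglyMeasurable φ circN) {c : ℝ} (hc : ∀ x, ‖φ x‖ ≤ c) :
    ‖symLp hf hφ hc‖ ≤ c * (eLpNorm (rootSymbol τ d f) 2 circN).toReal := by
  have hc0 : 0 ≤ c := (norm_nonneg _).trans (hc 0)
  rw [symLp, Lp.norm_toLp]
  have h := eLpNorm_le_mul_eLpNorm_of_ae_le_mul (c := c) (p := 2) (μ := circN)
    (f := fun x => rootSymbol τ d f x (φ x)) (g := rootSymbol τ d f) (.of_forall fun x => by
      rw [mul_comm]
      exact (ContinuousLinearMap.le_opNorm _ _).trans (by gcongr; exact hc x))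
  refine (ENNReal.toReal_mono (ENNReal.mul_ne_top ENNReal.ofReal_ne_top
    (memLp_rootSymbol hf).2.ne) h).trans ?_
  rw [ENNReal.toReal_mul, ENNReal.toReal_ofReal hc0]

lemma inner_symLp (hf : IsSpectralDensity τ d f) {φ : ℝ → Vec K}
    (hφ : AEStronglyMeasurable φ circN) {c : ℝ} (hc : ∀ x, ‖φ x‖ ≤ c) (u : Lp (Vec K) 2 circN) :
    inner ℂ (symLp hf hφ hc) u =
      ∫ x, inner ℂ (φ x) (ContinuousLinearMap.adjoint (rootSymbol τ d f x) (u x)) ∂circN := by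
  rw [L2.inner_def]
  refine integral_congr_ae ?_
  filter_upwards [coeFn_symLp hf hφ hc] with x hx
  rw [hx, ContinuousLinearMap.adjoint_inner_right]

/-- The element `e^{ijx} R v` of `L²`. -/
def symVec (hf : IsSpectralDensity τ d f) (j : ℤ) (v : Vec K) : Lp (Vec K) 2 circN :=
  symLp hf (aestronglyMeasurable_unimod_smul j v) fun x => (norm_unimod_smul j x v).le

lemma coeFn_symVec (hf : IsSpectralDensity τ d f) (j : ℤ) (v : Vec K) :
    ∀ᵐ x ∂circN, symVec hf j v x = unimod j x • rootSymbol τ d f x v := by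
  filter_upwards [coeFn_symLp hf (aestronglyMeasurable_unimod_smul j v)
    fun x => (norm_unimod_smul j x v).le] with x hx
  rw [symVec, hx, map_smul]

lemma rot_symVec (hf : IsSpectralDensity τ d f) (k j : ℤ) (v : Vec K) :
    rot k (symVec hf j v) = symVec hf (k + j) v := by
  refine Lp.ext ?_
  filter_upwards [coeFn_rot k (symVec hf j v), coeFn_symVec hf j v, coeFn_symVec hf (k + j) v]
    with x h1 h2 h3
  rw [h1, h2, h3, unimod_add, mul_smul]

lemma inner_symVec (hf : IsSpectralDensity τ d f) (j : ℤ) (v : Vec K) (u : Lp (Vec K) 2 circN) :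
    inner ℂ (symVec hf j v) u = ∫ x, inner ℂ v
      (unimod (-j) x • ContinuousLinearMap.adjoint (rootSymbol τ d f x) (u x)) ∂circN := by
  rw [symVec, inner_symLp]
  congr 1
  funext x
  rw [inner_smul_left, inner_smul_right, conj_unimod]

/-- The space of the past: the closed linear span of `e^{ijx} R δ_k`, `j ≤ -1`. -/
def pastSpace (hf : IsSpectralDensity τ d f) : Submodule ℂ (Lp (Vec K) 2 circN) :=
  (Submodule.span ℂ (Set.range fun p : K × ℕ =>
    symVec hf (-((p.2 : ℤ) + 1)) (basisVec p.1))).topologicalClosure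

lemma isClosed_pastSpace (hf : IsSpectralDensity τ d f) :
    IsClosed (pastSpace hf : Set (Lp (Vec K) 2 circN)) :=
  Submodule.isClosed_topologicalClosure _

instance (hf : IsSpectralDensity τ d f) : CompleteSpace (pastSpace hf) :=
  (isClosed_pastSpace hf).completeSpace_coe

lemma pastSpace_le (hf : IsSpectralDensity τ d f) {M : Submodule ℂ (Lp (Vec K) 2 circN)}
    (hM : IsClosed (M : Set (Lp (Vec K) 2 circN)))
    (h : ∀ (k : K) (n : ℕ), symVec hf (-((n : ℤ) + 1)) (basisVec k) ∈ M) : pastSpace hf ≤ M := by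
  refine Submodule.topologicalClosure_minimal _ ?_ hM
  rw [Submodule.span_le]
  rintro _ ⟨p, rfl⟩
  exact h p.1 p.2

lemma symVec_basisVec_mem_pastSpace (hf : IsSpectralDensity τ d f) (n : ℕ) (k : K) :
    symVec hf (-((n : ℤ) + 1)) (basisVec k) ∈ pastSpace hf :=
  Submodule.le_topologicalClosure _ (Submodule.subset_span ⟨(k, n), rfl⟩)

lemma symVec_eq_sum [Fintype K] (hf : IsSpectralDensity τ d f) (j : ℤ) (v : Vec K) :
    symVec hf j v = ∑ k : K, v k • symVec hf j (basisVec k) := by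
  refine Lp.ext ?_
  have hs : ∀ᵐ x ∂circN, ∀ k : K, (v k • symVec hf j (basisVec k) : Lp (Vec K) 2 circN) x =
      v k • (unimod j x • rootSymbol τ d f x (basisVec k)) := by
    rw [ae_all_iff]
    intro k
    filter_upwards [Lp.coeFn_smul (v k) (symVec hf j (basisVec k)),
      coeFn_symVec hf j (basisVec k)] with x h1 h2
    rw [h1, Pi.smul_apply, h2]
  filter_upwards [coeFn_symVec hf j v, hs, Lp.coeFn_finsetSum Finset.univ
    (fun k : K => v k • symVec hf j (basisVec k))] with x h1 h2 h3
  rw [h1, h3, Finset.sum_apply, Finset.sum_congr rfl fun k _ => h2 k]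
  conv_lhs => rw [← sum_smul_basisVec v, map_sum, Finset.smul_sum]
  exact Finset.sum_congr rfl fun k _ => by rw [map_smul, smul_comm]

lemma symVec_mem_pastSpace (hf : IsSpectralDensity τ d f) (n : ℕ) (v : Vec K) :
    symVec hf (-((n : ℤ) + 1)) v ∈ pastSpace hf := by
  have := Fintype.ofFinite K
  rw [symVec_eq_sum]
  exact Submodule.sum_mem _ fun k _ =>
    Submodule.smul_mem _ _ (symVec_basisVec_mem_pastSpace hf n k)

/-- Shifting backwards maps generators of the past to generators. This is the invariance required by
the bounds on prediction errors. -/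
lemma rot_neg_one_mem_pastSpace (hf : IsSpectralDensity τ d f) :
    ∀ u ∈ pastSpace hf, rot (-1) u ∈ pastSpace hf := by
  have h : pastSpace hf ≤ (pastSpace hf).comap (rot (-1)).toLinearMap := by
    refine pastSpace_le hf ((isClosed_pastSpace hf).preimage (rot (-1)).continuous) fun k n => ?_
    rw [Submodule.mem_comap]
    show rot (-1) _ ∈ _
    rw [rot_symVec]
    convert symVec_basisVec_mem_pastSpace hf (n + 1) k using 2
    push_cast; ring
  exact fun u hu => h hu

lemma mem_pastSpace_orthogonal (hf : IsSpectralDensity τ d f) {Z : Lp (Vec K) 2 circN}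
    (h : ∀ (k : K) (n : ℕ), inner ℂ (symVec hf (-((n : ℤ) + 1)) (basisVec k)) Z = (0 : ℂ)) :
    Z ∈ (pastSpace hf)ᗮ := by
  have hle : pastSpace hf ≤ (Submodule.span ℂ {Z})ᗮ :=
    pastSpace_le hf (Submodule.isClosed_orthogonal _) fun k n =>
      Submodule.mem_orthogonal_singleton_iff_inner_left.2 (h k n)
  rw [Submodule.mem_orthogonal]
  exact fun u hu => Submodule.mem_orthogonal_singleton_iff_inner_left.1 (hle hu)

/-! ### The prediction error of `B` -/

/-- The element `R B` of `L²`. -/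
def targetLp (hf : IsSpectralDensity τ d f) {b : ℕ → Vec K} (hb : Summable fun j => ‖b j‖) :
    Lp (Vec K) 2 circN :=
  symLp hf (continuous_Bfun hb).aestronglyMeasurable (norm_Bfun_le hb)

/-- The prediction error of `R B`. -/
def errorLp (hf : IsSpectralDensity τ d f) {b : ℕ → Vec K} (hb : Summable fun j => ‖b j‖) :
    Lp (Vec K) 2 circN :=
  targetLp hf hb - (pastSpace hf).starProjection (targetLp hf hb)

lemma errorLp_mem_orthogonal (hf : IsSpectralDensity τ d f) {b : ℕ → Vec K}
    (hb : Summable fun j => ‖b j‖) : errorLp hf hb ∈ (pastSpace hf)ᗮ :=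
  (pastSpace hf).sub_starProjection_mem_orthogonal _

/-- The series of B converges uniformly, and R lies in L², so multiplication by R turns uniform into
L² convergence. -/
lemma tendsto_sum_symVec (hf : IsSpectralDensity τ d f) {b : ℕ → Vec K}
    (hb : Summable fun j => ‖b j‖) :
    Tendsto (fun n => ∑ j ∈ Finset.range n, symVec hf j (b j)) atTop (𝓝 (targetLp hf hb)) := by
  rw [tendsto_iff_norm_sub_tendsto_zero]
  have h0 : Tendsto (fun n => (∑' j, ‖b (j + n)‖) *
      (eLpNorm (rootSymbol τ d f) 2 circN).toReal) atTop (𝓝 0) := by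
    rw [show (0 : ℝ) = 0 * (eLpNorm (rootSymbol τ d f) 2 circN).toReal by ring]
    exact (tendsto_sum_nat_add fun j => ‖b j‖).mul_const _
  refine squeeze_zero (fun _ => norm_nonneg _) (fun n => ?_) h0
  rw [norm_sub_rev]
  refine le_trans (le_of_eq ?_) (norm_symLp_le hf
    (((continuous_Bfun hb).sub (continuous_partialB b n)).aestronglyMeasurable)
    (norm_Bfun_sub_partialB_le hb n))
  congr 1
  refine Lp.ext ?_
  have hs : ∀ᵐ x ∂circN, ∀ j : ℕ, symVec hf j (b j) x =
      unimod j x • rootSymbol τ d f x (b j) := by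
    rw [ae_all_iff]
    exact fun j => coeFn_symVec hf j (b j)
  filter_upwards [hs, coeFn_symLp hf (continuous_Bfun hb).aestronglyMeasurable (norm_Bfun_le hb),
    Lp.coeFn_sub (targetLp hf hb) (∑ j ∈ Finset.range n, symVec hf j (b j)),
    Lp.coeFn_finsetSum (Finset.range n) (fun j : ℕ => symVec hf j (b j)),
    coeFn_symLp hf (((continuous_Bfun hb).sub (continuous_partialB b n)).aestronglyMeasurable)
    (norm_Bfun_sub_partialB_le hb n)] with x h1 h2 h3 h4 h5
  rw [h3, Pi.sub_apply, h4, h5, targetLp, h2, Pi.sub_apply, map_sub, partialB, map_sum,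
    Finset.sum_apply]
  congr 1
  exact Finset.sum_congr rfl fun j _ => by rw [h1 j, map_smul]

/-- The prediction error of `R B` is essentially bounded. -/
theorem exists_ae_norm_errorLp_le (hf : IsSpectralDensity τ d f) {b : ℕ → Vec K}
    (hb : Summable fun j => ‖b j‖) (hsum : Summable fun j : ℕ => ((j : ℝ) + 1) * ‖b j‖) :
    ∃ c, ∀ᵐ x ∂circN, ‖errorLp hf hb x‖ ≤ c := by
  set M := (eLpNorm (rootSymbol τ d f) 2 circN).toReal
  set N := pastSpace hf with hN
  have hM : 0 ≤ M := ENNReal.toReal_nonneg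
  refine ⟨(∑' j : ℕ, ((j : ℝ) + 1) * ‖b j‖) * M, ?_⟩
  -- The j-step bound is applied to the vector R b_j, whose L² norm is at most M‖b_j‖; the factor j
  -- + 1 is what the weighted summability absorbs.
  have hbd : ∀ᵐ x ∂circN, ∀ j : ℕ,
      ‖(symVec hf j (b j) - N.starProjection (symVec hf j (b j)) : Lp (Vec K) 2 circN) x‖ ≤
        ((j : ℝ) + 1) * (‖b j‖ * M) := by
    rw [ae_all_iff]
    intro j
    have h1 := ae_norm_rot_sub_starProjection_le (rot_neg_one_mem_pastSpace hf)
      (y := symVec hf 0 (b j)) (by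
        rw [rot_symVec]
        simpa using symVec_mem_pastSpace hf 0 (b j)) j
    rw [rot_symVec, add_zero] at h1
    filter_upwards [h1] with x hx
    refine hx.trans ?_
    gcongr
    exact norm_symLp_le _ _ _
  set g : ℕ → Lp (Vec K) 2 circN := fun n => ∑ j ∈ Finset.range n,
    (symVec hf j (b j) - N.starProjection (symVec hf j (b j))) with hg
  have hlim : Tendsto g atTop (𝓝 (errorLp hf hb)) := by
    have h := tendsto_sum_symVec hf hb
    have h2 := h.sub ((N.starProjection.continuous.tendsto _).comp h)
    refine h2.congr fun n => ?_
    simp only [hg, Function.comp_apply, map_sum, Finset.sum_sub_distrib]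
  -- L² convergence gives pointwise convergence along a subsequence, enough to pass a uniform
  -- pointwise bound to the limit.
  obtain ⟨ns, -, hns⟩ := (tendstoInMeasure_of_tendsto_Lp hlim).exists_seq_tendsto_ae
  have hcoe : ∀ᵐ x ∂circN, ∀ n, g n x = ∑ j ∈ Finset.range n,
      (symVec hf j (b j) - N.starProjection (symVec hf j (b j)) : Lp (Vec K) 2 circN) x := by
    rw [ae_all_iff]
    intro n
    filter_upwards [Lp.coeFn_finsetSum (Finset.range n) fun j : ℕ =>
      symVec hf j (b j) - N.starProjection (symVec hf j (b j))] with x hx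
    rw [hg, hx, Finset.sum_apply]
  filter_upwards [hbd, hns, hcoe] with x h1 h2 h3
  refine le_of_tendsto h2.norm (.of_forall fun n => ?_)
  rw [h3]
  refine (norm_sum_le _ _).trans ((Finset.sum_le_sum fun j _ => h1 j).trans ?_)
  simp only [← mul_assoc]
  rw [← Finset.sum_mul]
  gcongr
  exact hsum.sum_le_tsum _ fun _ _ => by positivity

end

section

variable {K : Set ℕ+} {τ d : ℕ} {f : ℝ → Vec K →L[ℂ] Vec K}

/-! ### The form of `F_τ` as an inner product -/

/-- The inverse of the adjoint of `R`. -/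
def dualRoot (τ d : ℕ) (f : ℝ → Vec K →L[ℂ] Vec K) (x : ℝ) : Vec K →L[ℂ] Vec K :=
  (weight τ d x : ℂ) • (rootSymbol τ d f x * Ring.inverse (f x))

lemma adjoint_rootSymbol (f : ℝ → Vec K →L[ℂ] Vec K) (x : ℝ) :
    ContinuousLinearMap.adjoint (rootSymbol τ d f x) =
      (starRingEnd ℂ) (chi τ d x) • sqrtDensity f x := by
  rw [rootSymbol, map_smulₛₗ, adjoint_sqrtDensity]

lemma adjoint_rootSymbol_mul_dualRoot {x : ℝ} (hx : (f x).IsPositive) (hu : IsUnit (f x))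
    (hχ : chi τ d x ≠ 0) :
    ContinuousLinearMap.adjoint (rootSymbol τ d f x) * dualRoot τ d f x = 1 := by
  have hχ' : (starRingEnd ℂ) (chi τ d x) ≠ 0 := by simpa using hχ
  rw [adjoint_rootSymbol, dualRoot, rootSymbol, smul_mul_assoc, mul_smul_comm, smul_mul_assoc,
    mul_smul_comm, smul_smul, smul_smul, ← mul_assoc, sqrtDensity_mul_self hx,
    Ring.mul_inverse_cancel _ hu, weight_eq_complex]
  rw [show (starRingEnd ℂ) (chi τ d x) * ((chi τ d x)⁻¹ * ((starRingEnd ℂ) (chi τ d x))⁻¹) *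
    chi τ d x = 1 by field_simp, one_smul]

lemma dualRoot_mul_adjoint_rootSymbol {x : ℝ} (hx : (f x).IsPositive) (hu : IsUnit (f x))
    (hχ : chi τ d x ≠ 0) :
    dualRoot τ d f x * ContinuousLinearMap.adjoint (rootSymbol τ d f x) = 1 := by
  have hχ' : (starRingEnd ℂ) (chi τ d x) ≠ 0 := by simpa using hχ
  have h : IsUnit (ContinuousLinearMap.adjoint (rootSymbol τ d f x)) := by
    rw [adjoint_rootSymbol]
    exact (isUnit_sqrtDensity hx hu).smul (Units.mk0 _ hχ')
  obtain ⟨u, hu'⟩ := h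
  have h1 := adjoint_rootSymbol_mul_dualRoot hx hu hχ
  rw [← hu'] at h1 ⊢
  rw [← Units.inv_eq_of_mul_eq_one_right h1, Units.inv_mul]

/-- Because R⁻¹(R*)⁻¹ is the weighted inverse of f, the map C ↦ (R*)⁻¹C turns the form of F_τ into
the plain L² inner product. -/
lemma inner_dualRoot {x : ℝ} (hx : (f x).IsPositive) (hu : IsUnit (f x))
    (hχ : chi τ d x ≠ 0) (v c : Vec K) :
    inner ℂ (dualRoot τ d f x v) (dualRoot τ d f x c) =
      (weight τ d x : ℂ) * inner ℂ v (Ring.inverse (f x) c) := by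
  conv_lhs => enter [3]; rw [dualRoot, smul_apply, clm_mul_apply]
  rw [inner_smul_right, ← ContinuousLinearMap.adjoint_inner_left, ← clm_mul_apply,
    adjoint_rootSymbol_mul_dualRoot hx hu hχ]
  rfl

lemma measurable_weight (τ d : ℕ) : Measurable (weight τ d) := by
  unfold weight; fun_prop

lemma HasSeries.sub {C C' : ℝ → Vec K} {c c' : ℕ → Vec K} (h : HasSeries C c)
    (h' : HasSeries C' c') : HasSeries (fun x => C x - C' x) (fun j => c j - c' j) := by
  have hi : ∀ {D : ℝ → Vec K}, MemLp D 2 circ → ∀ j : ℤ,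
      Integrable (fun x => unimod j x • D x) circ := fun hD j =>
    (hD.integrable one_le_two).bdd_smul 1 (continuous_unimod j).aestronglyMeasurable
      (.of_forall fun x => by simp)
  refine ⟨h.memLp.sub h'.memLp, fun j => ?_, fun j => ?_⟩
  · rw [← h.coeff j, ← h'.coeff j, ← smul_sub]
    congr 1
    simp only [exp_neg_natCast_eq_unimod, smul_sub]
    exact integral_sub (hi h.memLp _) (hi h'.memLp _)
  · have h1 := h.coeff_neg j
    have h2 := h'.coeff_neg j
    simp only [exp_natCast_add_one_eq_unimod, smul_sub] at *
    rw [integral_sub (hi h.memLp _) (hi h'.memLp _), h1, h2, sub_zero]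

lemma HasSeries.ae_eq {C C' : ℝ → Vec K} {c : ℕ → Vec K} (h : HasSeries C c)
    (h' : HasSeries C' c) : C =ᵐ[circ] C' := by
  have hs := h.sub h'
  have := ae_eq_zero_of_forall_integral_unimod (hs.memLp.integrable one_le_two) fun j => by
    -- Integration against e^{ijx} extracts the coefficient of index -j. Positive j are therefore
    -- the vanishing negative coefficients, and j ≤ 0 gives the entries of the sequence.
    rcases lt_or_ge 0 j with hj | hj
    · have h1 := hs.coeff_neg (j.toNat - 1)
      simp only [exp_natCast_add_one_eq_unimod] at h1
      rwa [show ((j.toNat - 1 : ℕ) : ℤ) + 1 = j by omega] at h1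
    · have h1 := hs.coeff (-j).toNat
      simp only [exp_neg_natCast_eq_unimod, sub_self] at h1
      rw [show -((-j).toNat : ℤ) = j by omega, smul_eq_zero, or_iff_right] at h1
      · exact h1
      · have : (Real.pi : ℂ) ≠ 0 := by exact_mod_cast Real.pi_pos.ne'
        simp [this]
  filter_upwards [this] with x hx
  exact sub_eq_zero.1 hx

lemma HasSeries.coeff_congr {C C' : ℝ → Vec K} {c c' : ℕ → Vec K} (h : HasSeries C c)
    (h' : HasSeries C' c') (hC : C =ᵐ[circ] C') : c = c' := by
  funext j
  rw [← h.coeff j, ← h'.coeff j]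
  congr 1
  refine integral_congr_ae ?_
  filter_upwards [hC] with x hx
  rw [hx]

/-- A Parseval identity: V is integrable and the norms ‖b_j‖ are summable, so sum and integral may
be exchanged. -/
lemma seqInner_eq_integral {V : ℝ → Vec K} {v : ℕ → Vec K} (hV : HasSeries V v)
    {b : ℕ → Vec K} (hb : Summable fun j => ‖b j‖) :
    seqInner b v = ∫ x, inner ℂ (V x) (Bfun b x) ∂circN := by
  have hV1 : Integrable V circN := integrable_circN.2 (hV.memLp.integrable one_le_two)
  have hVu : ∀ j : ℤ, Integrable (fun x => unimod j x • V x) circN := fun j =>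
    hV1.bdd_smul 1 (continuous_unimod j).aestronglyMeasurable (.of_forall fun x => by simp)
  have hterm : ∀ j : ℕ, ∀ x, inner ℂ (V x) (unimod j x • b j) =
      inner ℂ (unimod (-j) x • V x) (b j) := fun j x => by
    rw [inner_smul_left, inner_smul_right, conj_unimod, neg_neg]
  have hint : ∀ j : ℕ, Integrable (fun x => inner ℂ (V x) (unimod j x • b j)) circN := fun j => by
    simp only [hterm]
    exact (hVu _).inner_const _
  have hval : ∀ j : ℕ, ∫ x, inner ℂ (V x) (unimod j x • b j) ∂circN = inner ℂ (v j) (b j) := by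
    intro j
    simp only [hterm]
    rw [← hV.coeff j, ← integral_circN]
    simp only [exp_neg_natCast_eq_unimod]
    have h := integral_inner (hVu (-j)) (b j) (𝕜 := ℂ)
    rw [← inner_conj_symm, ← h, ← integral_conj]
    simp only [inner_conj_symm]
  have hnorm : Summable fun j : ℕ => ∫ x, ‖inner ℂ (V x) (unimod j x • b j)‖ ∂circN := by
    refine Summable.of_nonneg_of_le (fun j => integral_nonneg fun x => norm_nonneg _)
      (fun j => ?_) (hb.mul_left (∫ x, ‖V x‖ ∂circN))
    rw [← integral_mul_const]
    refine integral_mono (hint j).norm (hV1.norm.mul_const _) fun x => ?_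
    exact (norm_inner_le_norm _ _).trans_eq (by rw [norm_unimod_smul])
  have h := hasSum_integral_of_summable_integral_norm hint hnorm
  simp only [hval] at h
  rw [seqInner, h.tsum_eq]
  refine integral_congr_ae (.of_forall fun x => ?_)
  simp only [Bfun_eq]
  exact ((innerSL ℂ (V x)).map_tsum (summable_unimod_smul hb x)).symm

/-- The pointwise conditions that hold almost everywhere under the minimality condition. -/
lemma ae_regular (hτ : 0 < τ) (hf : IsSpectralDensity τ d f) (hmin : Minimality τ d f) :
    ∀ᵐ x ∂circN, (f x).IsPositive ∧ IsUnit (f x) ∧ chi τ d x ≠ 0 := by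
  rw [ae_circN]
  filter_upwards [hf.positive, hmin.1, ae_chi_ne_zero d hτ] with x h1 h2 h3
  exact ⟨h1, h2, h3⟩

lemma finiteForm_of_memLp (hτ : 0 < τ) (hf : IsSpectralDensity τ d f) (hmin : Minimality τ d f)
    {C : ℝ → Vec K} (hC : MemLp (fun x => dualRoot τ d f x (C x)) 2 circN) :
    FiniteForm τ d f C := by
  refine integrable_circN.1 (((hC.integrable_norm_pow two_ne_zero).ofReal (𝕜 := ℂ)).congr ?_)
  filter_upwards [ae_regular hτ hf hmin] with x ⟨h1, h2, h3⟩
  rw [← inner_dualRoot h1 h2 h3, inner_self_eq_norm_sq_to_K]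
  simp

lemma toeplitzForm_eq_inner (hτ : 0 < τ) (hf : IsSpectralDensity τ d f)
    (hmin : Minimality τ d f) {C V : ℝ → Vec K} {zC zV : Lp (Vec K) 2 circN}
    (hC : ∀ᵐ x ∂circN, zC x = dualRoot τ d f x (C x))
    (hV : ∀ᵐ x ∂circN, zV x = dualRoot τ d f x (V x)) :
    toeplitzForm τ d f C V = inner ℂ zV zC := by
  rw [L2.inner_def, toeplitzForm, ← smul_eq_mul, ← integral_circN]
  refine integral_congr_ae ?_
  filter_upwards [ae_regular hτ hf hmin, hC, hV] with x ⟨h1, h2, h3⟩ h4 h5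
  rw [h4, h5, inner_dualRoot h1 h2 h3]

variable [Finite K]

lemma aestronglyMeasurable_inverse (hf : IsSpectralDensity τ d f) :
    AEStronglyMeasurable (fun x => Ring.inverse (f x)) circ := by
  have := finiteDimensional_vec (K := K)
  have : FiniteDimensional ℂ (Vec K →L[ℂ] Vec K) := inferInstance
  have : ProperSpace (Vec K →L[ℂ] Vec K) := FiniteDimensional.proper ℂ _
  borelize (Vec K →L[ℂ] Vec K)
  exact (measurable_ringInverse.comp_aemeasurable
    (aestronglyMeasurable_clm hf.measurable).aemeasurable).aestronglyMeasurable

lemma aestronglyMeasurable_dualRoot (hf : IsSpectralDensity τ d f) :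
    AEStronglyMeasurable (dualRoot τ d f) circN :=
  (Complex.measurable_ofReal.comp (measurable_weight τ d)).aestronglyMeasurable.smul
    ((memLp_rootSymbol hf).1.mul (aestronglyMeasurable_circN.2 (aestronglyMeasurable_inverse hf)))

lemma memLp_dualRoot_apply (hτ : 0 < τ) (hf : IsSpectralDensity τ d f) (hmin : Minimality τ d f)
    {C : ℝ → Vec K} (hC : MemLp C 2 circ) (hfin : FiniteForm τ d f C) :
    MemLp (fun x => dualRoot τ d f x (C x)) 2 circN := by
  have hm : AEStronglyMeasurable (fun x => dualRoot τ d f x (C x)) circN :=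
    aestronglyMeasurable_apply (aestronglyMeasurable_dualRoot hf)
      (aestronglyMeasurable_circN.2 hC.1)
  rw [memLp_two_iff_integrable_sq_norm hm]
  refine ((integrable_circN.2 hfin).norm).congr ?_
  filter_upwards [ae_regular hτ hf hmin] with x ⟨h1, h2, h3⟩
  rw [← inner_dualRoot h1 h2 h3, inner_self_eq_norm_sq_to_K]
  simp

lemma FiniteForm.sub (hτ : 0 < τ) (hf : IsSpectralDensity τ d f) (hmin : Minimality τ d f)
    {C C' : ℝ → Vec K} (hC : MemLp C 2 circ) (hC' : MemLp C' 2 circ)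
    (h : FiniteForm τ d f C) (h' : FiniteForm τ d f C') :
    FiniteForm τ d f (fun x => C x - C' x) := by
  refine finiteForm_of_memLp hτ hf hmin ?_
  simp only [map_sub]
  exact (memLp_dualRoot_apply hτ hf hmin hC h).sub (memLp_dualRoot_apply hτ hf hmin hC' h')

/-- The equation `F_τ c = b` has at most one solution. -/
theorem ToeplitzMaps.unique (hτ : 0 < τ) (hf : IsSpectralDensity τ d f)
    (hmin : Minimality τ d f) {b c c' : ℕ → Vec K} (h : ToeplitzMaps τ d f c b)
    (h' : ToeplitzMaps τ d f c' b) : c = c' := by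
  obtain ⟨C, hC, hfin, hm⟩ := h
  obtain ⟨C', hC', hfin', hm'⟩ := h'
  have hfs := FiniteForm.sub hτ hf hmin hC.memLp hC'.memLp hfin hfin'
  -- Both equations are tested against the difference of the two solutions; the form then vanishes
  -- on that difference and is positive definite.
  have e := (hm _ _ (hC.sub hC') hfs).trans (hm' _ _ (hC.sub hC') hfs).symm
  set z := (memLp_dualRoot_apply hτ hf hmin hC.memLp hfin).toLp _
  set z' := (memLp_dualRoot_apply hτ hf hmin hC'.memLp hfin').toLp _
  have hz : ∀ᵐ x ∂circN, z x = dualRoot τ d f x (C x) := MemLp.coeFn_toLp _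
  have hz' : ∀ᵐ x ∂circN, z' x = dualRoot τ d f x (C' x) := MemLp.coeFn_toLp _
  have hzz : ∀ᵐ x ∂circN, (z - z' : Lp (Vec K) 2 circN) x = dualRoot τ d f x (C x - C' x) := by
    filter_upwards [hz, hz', Lp.coeFn_sub z z'] with x h1 h2 h3
    rw [h3, Pi.sub_apply, h1, h2, map_sub]
  rw [toeplitzForm_eq_inner hτ hf hmin hz hzz, toeplitzForm_eq_inner hτ hf hmin hz' hzz,
    ← sub_eq_zero, ← inner_sub_right, inner_self_eq_zero] at e
  refine hC.coeff_congr hC' ?_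
  rw [← ae_circN]
  rw [e] at hzz
  filter_upwards [hzz, Lp.coeFn_zero (Vec K) 2 circN, ae_regular hτ hf hmin]
    with x h1 h2 ⟨h3, h4, h5⟩
  rw [h2, Pi.zero_apply] at h1
  have h6 := clm_mul_apply (ContinuousLinearMap.adjoint (rootSymbol τ d f x)) (dualRoot τ d f x)
    (C x - C' x)
  rw [adjoint_rootSymbol_mul_dualRoot h3 h4 h5, ← h1, map_zero] at h6
  exact sub_eq_zero.1 h6

/-! ### The solution of `F_τ c = b` -/

/-- The function `R* U`, where `U` is the prediction error of `R B`. -/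
def solutionFun (hf : IsSpectralDensity τ d f) {b : ℕ → Vec K} (hb : Summable fun j => ‖b j‖)
    (x : ℝ) : Vec K :=
  ContinuousLinearMap.adjoint (rootSymbol τ d f x) (errorLp hf hb x)

/-- The Fourier coefficients of `R* U`. -/
def solutionSeq (hf : IsSpectralDensity τ d f) {b : ℕ → Vec K} (hb : Summable fun j => ‖b j‖)
    (j : ℕ) : Vec K :=
  (1 / (2 * Real.pi) : ℂ) • ∫ x, Complex.exp (-(Complex.I * x * j)) • solutionFun hf hb x ∂circ

/-- Essential boundedness of the error U is decisive here: with both factors merely in L², the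
product R*U would only be integrable. -/
lemma memLp_solutionFun (hf : IsSpectralDensity τ d f) {b : ℕ → Vec K}
    (hb : Summable fun j => ‖b j‖) (hsum : Summable fun j : ℕ => ((j : ℝ) + 1) * ‖b j‖) :
    MemLp (solutionFun hf hb) 2 circN := by
  obtain ⟨c, hc⟩ := exists_ae_norm_errorLp_le hf hb hsum
  have hR := memLp_rootSymbol hf
  refine hR.of_le_mul (c := c) (aestronglyMeasurable_apply
    (ContinuousLinearMap.adjoint.continuous.comp_aestronglyMeasurable hR.1) (Lp.memLp _).1) ?_
  filter_upwards [hc] with x hx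
  rw [mul_comm]
  refine (ContinuousLinearMap.le_opNorm _ _).trans ?_
  rw [LinearIsometryEquiv.norm_map]
  gcongr

/-- Pairing U with e^{-i(j+1)x} R v gives the coefficient of R*U at index -(j+1), paired with v.
Orthogonality to the past makes it vanish. -/
lemma hasSeries_solutionFun (hf : IsSpectralDensity τ d f) {b : ℕ → Vec K}
    (hb : Summable fun j => ‖b j‖) (hsum : Summable fun j : ℕ => ((j : ℝ) + 1) * ‖b j‖) :
    HasSeries (solutionFun hf hb) (solutionSeq hf hb) := by
  have hm := memLp_solutionFun hf hb hsum
  refine ⟨?_, fun j => rfl, fun j => ?_⟩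
  · refine hm.of_measure_le_smul (c := ENNReal.ofReal (2 * Real.pi)) ENNReal.ofReal_ne_top ?_
    rw [circN, smul_smul, ← ENNReal.ofReal_mul (by positivity)]
    have := Real.pi_pos.ne'
    rw [show 2 * Real.pi * (1 / (2 * Real.pi)) = 1 by field_simp, ENNReal.ofReal_one, one_smul]
  · rw [integral_circ_eq_zero_iff]
    simp only [exp_natCast_add_one_eq_unimod]
    have hi : Integrable (fun x => unimod ((j : ℤ) + 1) x • solutionFun hf hb x) circN :=
      (hm.integrable one_le_two).bdd_smul 1 (continuous_unimod _).aestronglyMeasurable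
        (.of_forall fun x => by simp)
    refine integral_eq_zero_of_forall_integral_inner_eq_zero ℂ _ hi fun v => ?_
    have h := inner_symVec hf (-((j : ℤ) + 1)) v (errorLp hf hb)
    rw [neg_neg] at h
    rw [← (Submodule.mem_orthogonal _ _).1 (errorLp_mem_orthogonal hf hb) _
      (symVec_mem_pastSpace hf j v), h]
    rfl

lemma ae_errorLp_eq (hτ : 0 < τ) (hf : IsSpectralDensity τ d f) (hmin : Minimality τ d f)
    {b : ℕ → Vec K} (hb : Summable fun j => ‖b j‖) :
    ∀ᵐ x ∂circN, errorLp hf hb x = dualRoot τ d f x (solutionFun hf hb x) := by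
  filter_upwards [ae_regular hτ hf hmin] with x ⟨h1, h2, h3⟩
  rw [solutionFun, ← clm_mul_apply, dualRoot_mul_adjoint_rootSymbol h1 h2 h3]
  rfl

lemma finiteForm_solutionFun (hτ : 0 < τ) (hf : IsSpectralDensity τ d f)
    (hmin : Minimality τ d f) {b : ℕ → Vec K} (hb : Summable fun j => ‖b j‖) :
    FiniteForm τ d f (solutionFun hf hb) :=
  finiteForm_of_memLp hτ hf hmin ((memLp_congr_ae (ae_errorLp_eq hτ hf hmin hb)).1 (Lp.memLp _))

/-- `R* U` solves the equation `F_τ c = b`. -/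
theorem toeplitzForm_solutionFun (hτ : 0 < τ) (hf : IsSpectralDensity τ d f)
    (hmin : Minimality τ d f) {b : ℕ → Vec K} (hb : Summable fun j => ‖b j‖)
    {v : ℕ → Vec K} {V : ℝ → Vec K} (hV : HasSeries V v) (hfin : FiniteForm τ d f V) :
    toeplitzForm τ d f (solutionFun hf hb) V = seqInner b v := by
  set z := (memLp_dualRoot_apply hτ hf hmin hV.memLp hfin).toLp _
  have hz : ∀ᵐ x ∂circN, z x = dualRoot τ d f x (V x) := MemLp.coeFn_toLp _
  have hRz : ∀ᵐ x ∂circN, ContinuousLinearMap.adjoint (rootSymbol τ d f x) (z x) = V x := by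
    filter_upwards [hz, ae_regular hτ hf hmin] with x h ⟨h1, h2, h3⟩
    rw [h, ← clm_mul_apply, adjoint_rootSymbol_mul_dualRoot h1 h2 h3]
    rfl
  have hVi : Integrable V circN := integrable_circN.2 (hV.memLp.integrable one_le_two)
  -- The inner products of z = (R*)⁻¹V with the generators of the past are coordinates of the
  -- negative Fourier coefficients of V, which are zero.
  have horth : z ∈ (pastSpace hf)ᗮ := by
    refine mem_pastSpace_orthogonal hf fun k n => ?_
    rw [inner_symVec, neg_neg]
    have h0 := hV.coeff_neg n
    simp only [exp_natCast_add_one_eq_unimod] at h0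
    rw [integral_circ_eq_zero_iff] at h0
    have hi : Integrable (fun x => unimod ((n : ℤ) + 1) x • V x) circN := hVi.bdd_smul 1
      (continuous_unimod _).aestronglyMeasurable (.of_forall fun x => by simp)
    rw [← inner_zero_right (basisVec k), ← h0, ← integral_inner hi]
    refine integral_congr_ae ?_
    filter_upwards [hRz] with x hx
    rw [hx]
  -- The projection part of the error drops out against z, and moving R across leaves the integral
  -- of ⟨V, B⟩.
  rw [toeplitzForm_eq_inner hτ hf hmin (ae_errorLp_eq hτ hf hmin hb) hz, errorLp, inner_sub_right,
    (Submodule.mem_orthogonal' _ _).1 horth _ ((pastSpace hf).starProjection_apply_mem _),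
    sub_zero, seqInner_eq_integral hV hb, ← inner_conj_symm, targetLp, inner_symLp, ← integral_conj]
  refine integral_congr_ae ?_
  filter_upwards [hRz] with x hx
  rw [hx, inner_conj_symm]

theorem toeplitzMaps_solutionSeq (hτ : 0 < τ) (hf : IsSpectralDensity τ d f)
    (hmin : Minimality τ d f) {b : ℕ → Vec K} (hb : Summable fun j => ‖b j‖)
    (hsum : Summable fun j : ℕ => ((j : ℝ) + 1) * ‖b j‖) :
    ToeplitzMaps τ d f (solutionSeq hf hb) b :=
  ⟨solutionFun hf hb, hasSeries_solutionFun hf hb hsum, finiteForm_solutionFun hτ hf hmin hb,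
    fun _ _ hV hfin => toeplitzForm_solutionFun hτ hf hmin hb hV hfin⟩

/-- `⟨b, F_τ⁻¹ b⟩` is the squared norm of the prediction error. -/
lemma seqInner_solutionSeq (hτ : 0 < τ) (hf : IsSpectralDensity τ d f)
    (hmin : Minimality τ d f) {b : ℕ → Vec K} (hb : Summable fun j => ‖b j‖)
    (hsum : Summable fun j : ℕ => ((j : ℝ) + 1) * ‖b j‖) :
    (seqInner b (solutionSeq hf hb)).re = ‖errorLp hf hb‖ ^ 2 := by
  have h := ae_errorLp_eq hτ hf hmin hb
  rw [← toeplitzForm_solutionFun hτ hf hmin hb (hasSeries_solutionFun hf hb hsum)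
    (finiteForm_solutionFun hτ hf hmin hb), toeplitzForm_eq_inner hτ hf hmin h h,
    inner_self_eq_norm_sq_to_K]
  norm_cast

end

section

variable {K : Set ℕ+} {τ d : ℕ} {f : ℝ → Vec K →L[ℂ] Vec K}

/-! ### Linear combinations of the past -/

/-- `pastComb` without the factor `χ`. -/
def pastSum (α : K × ℕ →₀ ℂ) (x : ℝ) : Vec K :=
  α.sum fun p z => z • unimod (-((p.2 : ℤ) + 1)) x • basisVec p.1

lemma pastComb_eq (α : K × ℕ →₀ ℂ) (x : ℝ) :
    pastComb τ d α x = chi τ d x • pastSum α x := by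
  rw [pastComb, pastSum, Finsupp.smul_sum]
  refine Finsupp.sum_congr fun p _ => ?_
  rw [exp_neg_natCast_add_one_eq_unimod, smul_smul, smul_smul]
  congr 1; ring

lemma continuous_pastSum (α : K × ℕ →₀ ℂ) : Continuous (pastSum α) :=
  continuous_finsetSum _ fun p _ =>
    (((continuous_unimod (-((p.2 : ℤ) + 1))).smul continuous_const).const_smul (α p) :
      Continuous fun x => α p • unimod (-((p.2 : ℤ) + 1)) x • basisVec p.1)

lemma norm_pastSum_le (α : K × ℕ →₀ ℂ) (x : ℝ) :
    ‖pastSum α x‖ ≤ ∑ p ∈ α.support, ‖α p‖ := by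
  refine (norm_sum_le _ _).trans (Finset.sum_le_sum fun p _ => ?_)
  rw [norm_smul, norm_unimod_smul, norm_basisVec, mul_one]

lemma aestronglyMeasurable_pastComb (α : K × ℕ →₀ ℂ) {μ : Measure ℝ} :
    AEStronglyMeasurable (pastComb τ d α) μ := by
  rw [show pastComb τ d α = fun x => chi τ d x • pastSum α x from funext (pastComb_eq α)]
  exact (measurable_chi τ d).aestronglyMeasurable.smul (continuous_pastSum α).aestronglyMeasurable

lemma sqNorm_eq_eLpNorm_sq (hf : ∀ᵐ x ∂circ, (f x).IsPositive) (g : ℝ → Vec K) :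
    sqNorm f g = eLpNorm (fun x => sqrtDensity f x (g x)) 2 circN ^ 2 := by
  have h := eLpNorm_nnreal_pow_eq_lintegral (f := fun x => sqrtDensity f x (g x)) (μ := circN)
    (p := 2) two_ne_zero
  rw [sqNorm_eq hf]
  simpa using h.symm

lemma sqNorm_eq_enorm_sq (hf : ∀ᵐ x ∂circ, (f x).IsPositive) {g : ℝ → Vec K}
    {u : Lp (Vec K) 2 circN} (hu : ∀ᵐ x ∂circN, u x = sqrtDensity f x (g x)) :
    sqNorm f g = ‖u‖ₑ ^ 2 := by
  rw [sqNorm_eq_eLpNorm_sq hf, Lp.enorm_def, eLpNorm_congr_ae hu]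

lemma enorm_sq_eq_ofReal {F : Type*} [NormedAddCommGroup F] (u : F) :
    ‖u‖ₑ ^ 2 = ENNReal.ofReal (‖u‖ ^ 2) := by
  rw [ENNReal.ofReal_pow (norm_nonneg _), ofReal_norm]

lemma rootSymbol_apply (x : ℝ) (v : Vec K) :
    rootSymbol τ d f x v = sqrtDensity f x (chi τ d x • v) := by
  rw [rootSymbol, smul_apply, map_smul]

lemma pastComb_mem_L2Past (f : ℝ → Vec K →L[ℂ] Vec K) (α : K × ℕ →₀ ℂ) :
    pastComb τ d α ∈ L2Past τ d f :=
  ⟨aestronglyMeasurable_pastComb α, fun ε hε => ⟨α, by simpa [sqNorm] using hε⟩⟩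

variable [Finite K]

/-- The minimal error is the infimum over the finite linear combinations of the past. -/
theorem minErr_eq_iInf_pastComb (hf : IsSpectralDensity τ d f) {b : ℕ → Vec K}
    (hb : Summable fun j => ‖b j‖) :
    minErr τ d b f = ⨅ α : K × ℕ →₀ ℂ, err τ d b (pastComb τ d α) f := by
  refine le_antisymm (le_iInf fun α => iInf₂_le _ (pastComb_mem_L2Past f α)) ?_
  refine le_iInf₂ fun h hh => ?_
  have hA : AEStronglyMeasurable (sqrtDensity f) circN :=
    aestronglyMeasurable_circN.2 (aestronglyMeasurable_sqrtDensity hf)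
  have hB : AEStronglyMeasurable (fun x => chi τ d x • Bfun b x) circN :=
    (measurable_chi τ d).aestronglyMeasurable.smul (continuous_Bfun hb).aestronglyMeasurable
  have hh1 := aestronglyMeasurable_circN.2 hh.1
  set E := eLpNorm (fun x => sqrtDensity f x (chi τ d x • Bfun b x - h x)) 2 circN with hE
  -- Approximate h within distance 1/n and use Minkowski's inequality. At n = 0 the inverse is ⊤ and
  -- the bound is vacuous.
  have key : ∀ n : ℕ, ⨅ α : K × ℕ →₀ ℂ, err τ d b (pastComb τ d α) f ≤ (E + (n : ENNReal)⁻¹) ^ 2 := by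
    intro n
    have hn : (n : ENNReal)⁻¹ ≠ 0 := ENNReal.inv_ne_zero.2 (ENNReal.natCast_ne_top n)
    obtain ⟨α, hα⟩ := hh.2 (((n : ENNReal)⁻¹) ^ 2) (pos_iff_ne_zero.2 (pow_ne_zero 2 hn))
    refine (iInf_le _ α).trans ?_
    rw [sqNorm_eq_eLpNorm_sq hf.positive] at hα
    rw [err, sqNorm_eq_eLpNorm_sq hf.positive]
    gcongr
    have h1 : (fun x => sqrtDensity f x (chi τ d x • Bfun b x - pastComb τ d α x)) =
        (fun x => sqrtDensity f x (chi τ d x • Bfun b x - h x)) +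
          fun x => sqrtDensity f x (h x - pastComb τ d α x) := by
      funext x
      rw [Pi.add_apply, ← map_add, sub_add_sub_cancel]
    rw [h1]
    refine (eLpNorm_add_le (aestronglyMeasurable_apply hA (hB.sub hh1))
      (aestronglyMeasurable_apply hA (hh1.sub (aestronglyMeasurable_pastComb α))) one_le_two).trans ?_
    exact add_le_add le_rfl (lt_of_pow_lt_pow_left' 2 hα).le
  rw [err, sqNorm_eq_eLpNorm_sq hf.positive, ← hE]
  have h1 : Tendsto (fun n : ℕ => E + (n : ENNReal)⁻¹) atTop (𝓝 (E + 0)) :=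
    tendsto_const_nhds.add ENNReal.tendsto_inv_nat_nhds_zero
  rw [add_zero] at h1
  exact ge_of_tendsto' ((ENNReal.continuous_pow 2).continuousAt.tendsto.comp h1) key

/-- The element of `L²` given by a finite linear combination of the past. -/
def pastLp (hf : IsSpectralDensity τ d f) (α : K × ℕ →₀ ℂ) : Lp (Vec K) 2 circN :=
  symLp hf (continuous_pastSum α).aestronglyMeasurable (norm_pastSum_le α)

lemma coeFn_pastLp (hf : IsSpectralDensity τ d f) (α : K × ℕ →₀ ℂ) :
    ∀ᵐ x ∂circN, pastLp hf α x = sqrtDensity f x (pastComb τ d α x) := by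
  filter_upwards [coeFn_symLp hf (continuous_pastSum α).aestronglyMeasurable (norm_pastSum_le α)]
    with x hx
  rw [pastLp, hx, rootSymbol_apply, pastComb_eq]

lemma pastLp_eq_sum (hf : IsSpectralDensity τ d f) (α : K × ℕ →₀ ℂ) :
    pastLp hf α = α.sum fun p z => z • symVec hf (-((p.2 : ℤ) + 1)) (basisVec p.1) := by
  refine Lp.ext ?_
  have hs : ∀ᵐ x ∂circN, ∀ p : K × ℕ,
      (α p • symVec hf (-((p.2 : ℤ) + 1)) (basisVec p.1) : Lp (Vec K) 2 circN) x =
        α p • (unimod (-((p.2 : ℤ) + 1)) x • rootSymbol τ d f x (basisVec p.1)) := by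
    rw [ae_all_iff]
    intro p
    filter_upwards [Lp.coeFn_smul (α p) (symVec hf (-((p.2 : ℤ) + 1)) (basisVec p.1)),
      coeFn_symVec hf (-((p.2 : ℤ) + 1)) (basisVec p.1)] with x h1 h2
    rw [h1, Pi.smul_apply, h2]
  filter_upwards [coeFn_symLp hf (continuous_pastSum α).aestronglyMeasurable (norm_pastSum_le α),
    hs, Lp.coeFn_finsetSum α.support
      (fun p => α p • symVec hf (-((p.2 : ℤ) + 1)) (basisVec p.1))] with x h1 h2 h3
  rw [pastLp, h1, Finsupp.sum, h3, Finset.sum_apply, pastSum, Finsupp.sum, map_sum]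
  exact Finset.sum_congr rfl fun p _ => by rw [h2, map_smul, map_smul]

lemma pastLp_mem_pastSpace (hf : IsSpectralDensity τ d f) (α : K × ℕ →₀ ℂ) :
    pastLp hf α ∈ pastSpace hf := by
  rw [pastLp_eq_sum]
  exact Submodule.sum_mem _ fun p _ =>
    Submodule.smul_mem _ _ (symVec_basisVec_mem_pastSpace hf p.2 p.1)

lemma exists_norm_sub_pastLp_lt (hf : IsSpectralDensity τ d f) {u : Lp (Vec K) 2 circN}
    (hu : u ∈ pastSpace hf) {ε : ℝ} (hε : 0 < ε) : ∃ α, ‖u - pastLp hf α‖ < ε := by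
  obtain ⟨v, hv, huv⟩ := Metric.mem_closure_iff.1
    (show u ∈ closure (_ : Set (Lp (Vec K) 2 circN)) from hu) ε hε
  obtain ⟨α, rfl⟩ := Finsupp.mem_span_range_iff_exists_finsupp.1 hv
  refine ⟨α, ?_⟩
  rw [pastLp_eq_sum, ← dist_eq_norm]
  exact huv

/-! ### The optimal spectral characteristic -/

variable {b : ℕ → Vec K} {C : ℝ → Vec K}

lemma aestronglyMeasurable_hTau (hf : IsSpectralDensity τ d f) (hb : Summable fun j => ‖b j‖)
    (hC : AEStronglyMeasurable C circ) : AEStronglyMeasurable (hTau τ d b f C) circ := by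
  have : Measurable fun x : ℝ =>
      (-(Complex.I * x)) ^ d / (1 - Complex.exp (Complex.I * x * τ)) ^ d := by fun_prop
  exact ((measurable_chi τ d).aestronglyMeasurable.smul
    (continuous_Bfun hb).aestronglyMeasurable).sub (this.aestronglyMeasurable.smul
      (aestronglyMeasurable_apply (aestronglyMeasurable_inverse hf) hC))

lemma coeFn_targetLp (hf : IsSpectralDensity τ d f) (hb : Summable fun j => ‖b j‖) :
    ∀ᵐ x ∂circN, targetLp hf hb x = sqrtDensity f x (chi τ d x • Bfun b x) := by
  filter_upwards [coeFn_symLp hf (continuous_Bfun hb).aestronglyMeasurable (norm_Bfun_le hb)]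
    with x hx
  rw [targetLp, hx, rootSymbol_apply]

/-- This is the origin of the formula: χB - h is the inverse of conj χ times f⁻¹C, and applying
f^{1/2} to it gives (R*)⁻¹C, the prediction error. -/
lemma ae_errorLp_eq_sub_hTau (hτ : 0 < τ) (hf : IsSpectralDensity τ d f)
    (hmin : Minimality τ d f) (hb : Summable fun j => ‖b j‖)
    (hC : C =ᵐ[circ] solutionFun hf hb) :
    ∀ᵐ x ∂circN, errorLp hf hb x =
      sqrtDensity f x (chi τ d x • Bfun b x - hTau τ d b f C x) := by
  rw [← ae_circN] at hC
  filter_upwards [hC, ae_regular hτ hf hmin, ae_errorLp_eq hτ hf hmin hb] with x h1 ⟨h2, h3, h4⟩ h5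
  rw [hTau, sub_sub_cancel, h5, h1, ← inv_conj_chi, dualRoot, map_smul, smul_apply, clm_mul_apply,
    rootSymbol, smul_apply, smul_smul, weight_eq_complex]
  congr 1
  field_simp

/-- Subtracting the error from the target identifies f^{1/2}h with the projection on the past;
membership in the past and optimality both come from this. -/
lemma ae_starProjection_eq (hτ : 0 < τ) (hf : IsSpectralDensity τ d f)
    (hmin : Minimality τ d f) (hb : Summable fun j => ‖b j‖)
    (hC : C =ᵐ[circ] solutionFun hf hb) :
    ∀ᵐ x ∂circN, (pastSpace hf).starProjection (targetLp hf hb) x =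
      sqrtDensity f x (hTau τ d b f C x) := by
  filter_upwards [ae_errorLp_eq_sub_hTau hτ hf hmin hb hC, coeFn_targetLp hf hb,
    Lp.coeFn_sub (targetLp hf hb) ((pastSpace hf).starProjection (targetLp hf hb))] with x h1 h2 h3
  rw [errorLp, h3, Pi.sub_apply, h2, map_sub] at h1
  exact sub_right_injective h1

lemma sqNorm_hTau_sub_pastComb (hτ : 0 < τ) (hf : IsSpectralDensity τ d f)
    (hmin : Minimality τ d f) (hb : Summable fun j => ‖b j‖)
    (hC : C =ᵐ[circ] solutionFun hf hb) (α : K × ℕ →₀ ℂ) :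
    sqNorm f (fun x => hTau τ d b f C x - pastComb τ d α x) =
      ‖(pastSpace hf).starProjection (targetLp hf hb) - pastLp hf α‖ₑ ^ 2 := by
  refine sqNorm_eq_enorm_sq hf.positive ?_
  filter_upwards [ae_starProjection_eq hτ hf hmin hb hC, coeFn_pastLp hf α,
    Lp.coeFn_sub ((pastSpace hf).starProjection (targetLp hf hb)) (pastLp hf α)] with x h1 h2 h3
  rw [h3, Pi.sub_apply, h1, h2, map_sub]

lemma hTau_mem_L2Past (hτ : 0 < τ) (hf : IsSpectralDensity τ d f)
    (hmin : Minimality τ d f) (hb : Summable fun j => ‖b j‖)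
    (hCm : AEStronglyMeasurable C circ) (hC : C =ᵐ[circ] solutionFun hf hb) :
    hTau τ d b f C ∈ L2Past τ d f := by
  refine ⟨aestronglyMeasurable_hTau hf hb hCm, fun ε hε => ?_⟩
  obtain ⟨δ, hδ, hδε⟩ : ∃ δ : ℝ, 0 < δ ∧ ENNReal.ofReal (δ ^ 2) ≤ ε := by
    rcases eq_or_ne ε ⊤ with rfl | hε'
    · exact ⟨1, one_pos, le_top⟩
    · refine ⟨Real.sqrt ε.toReal, Real.sqrt_pos.2 (ENNReal.toReal_pos hε.ne' hε'), ?_⟩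
      rw [Real.sq_sqrt ENNReal.toReal_nonneg, ENNReal.ofReal_toReal hε']
  obtain ⟨α, hα⟩ := exists_norm_sub_pastLp_lt hf
    ((pastSpace hf).starProjection_apply_mem (targetLp hf hb)) hδ
  refine ⟨α, lt_of_lt_of_le ?_ hδε⟩
  rw [sqNorm_hTau_sub_pastComb hτ hf hmin hb hC, enorm_sq_eq_ofReal,
    ENNReal.ofReal_lt_ofReal_iff (by positivity)]
  exact pow_lt_pow_left₀ hα (norm_nonneg _) two_ne_zero

lemma err_hTau (hτ : 0 < τ) (hf : IsSpectralDensity τ d f)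
    (hmin : Minimality τ d f) (hb : Summable fun j => ‖b j‖)
    (hC : C =ᵐ[circ] solutionFun hf hb) :
    err τ d b (hTau τ d b f C) f = ‖errorLp hf hb‖ₑ ^ 2 :=
  sqNorm_eq_enorm_sq hf.positive (ae_errorLp_eq_sub_hTau hτ hf hmin hb hC)

lemma err_pastComb_eq_enorm (hf : IsSpectralDensity τ d f) (hb : Summable fun j => ‖b j‖)
    (α : K × ℕ →₀ ℂ) :
    err τ d b (pastComb τ d α) f = ‖targetLp hf hb - pastLp hf α‖ₑ ^ 2 := by
  refine sqNorm_eq_enorm_sq hf.positive ?_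
  filter_upwards [coeFn_targetLp hf hb, coeFn_pastLp hf α,
    Lp.coeFn_sub (targetLp hf hb) (pastLp hf α)] with x h1 h2 h3
  rw [h3, Pi.sub_apply, h1, h2, map_sub]

/-- The Pythagorean identity for the errors of linear combinations of the past. -/
theorem err_pastComb (hτ : 0 < τ) (hf : IsSpectralDensity τ d f)
    (hmin : Minimality τ d f) (hb : Summable fun j => ‖b j‖)
    (hC : C =ᵐ[circ] solutionFun hf hb) (α : K × ℕ →₀ ℂ) :
    err τ d b (pastComb τ d α) f = err τ d b (hTau τ d b f C) f +
      sqNorm f (fun x => hTau τ d b f C x - pastComb τ d α x) := by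
  rw [err_pastComb_eq_enorm hf hb, err_hTau hτ hf hmin hb hC, sqNorm_hTau_sub_pastComb hτ hf hmin hb hC]
  have h2 : targetLp hf hb - pastLp hf α = errorLp hf hb +
      ((pastSpace hf).starProjection (targetLp hf hb) - pastLp hf α) := by
    rw [errorLp, sub_add_sub_cancel]
  have h3 : inner ℂ (errorLp hf hb)
      ((pastSpace hf).starProjection (targetLp hf hb) - pastLp hf α) = (0 : ℂ) :=
    (Submodule.mem_orthogonal' _ _).1 (errorLp_mem_orthogonal hf hb) _
      (Submodule.sub_mem _ ((pastSpace hf).starProjection_apply_mem _) (pastLp_mem_pastSpace hf α))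
  have h4 := norm_add_sq_eq_norm_sq_add_norm_sq_of_inner_eq_zero _ _ h3
  simp only [enorm_sq_eq_ofReal]
  rw [← ENNReal.ofReal_add (by positivity) (by positivity), h2]
  congr 1
  simpa only [sq] using h4

theorem minErr_eq_err_hTau (hτ : 0 < τ) (hf : IsSpectralDensity τ d f)
    (hmin : Minimality τ d f) (hb : Summable fun j => ‖b j‖)
    (hCm : AEStronglyMeasurable C circ) (hC : C =ᵐ[circ] solutionFun hf hb) :
    minErr τ d b f = err τ d b (hTau τ d b f C) f := by
  refine le_antisymm (iInf₂_le _ (hTau_mem_L2Past hτ hf hmin hb hCm hC)) ?_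
  rw [minErr_eq_iInf_pastComb hf hb]
  refine le_iInf fun α => ?_
  rw [err_pastComb hτ hf hmin hb hC]
  exact le_self_add

/-- Every solution of `F_τ c = b` is given by the prediction error. -/
lemma ToeplitzMaps.ae_eq_solutionFun (hτ : 0 < τ) (hf : IsSpectralDensity τ d f)
    (hmin : Minimality τ d f) (hb : Summable fun j => ‖b j‖)
    (hsum : Summable fun j : ℕ => ((j : ℝ) + 1) * ‖b j‖) {c : ℕ → Vec K}
    (hc : ToeplitzMaps τ d f c b) (hC : HasSeries C c) : C =ᵐ[circ] solutionFun hf hb := by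
  refine hC.ae_eq ?_
  rw [hc.unique hτ hf hmin (toeplitzMaps_solutionSeq hτ hf hmin hb hsum)]
  exact hasSeries_solutionFun hf hb hsum

/-- Under the minimality condition, `Δ(f) = ⟨b, F_τ⁻¹ b⟩`. -/
theorem minErr_eq_seqInner (hτ : 0 < τ) (hf : IsSpectralDensity τ d f)
    (hmin : Minimality τ d f) (hb : Summable fun j => ‖b j‖)
    (hsum : Summable fun j : ℕ => ((j : ℝ) + 1) * ‖b j‖) {c : ℕ → Vec K}
    (hc : ToeplitzMaps τ d f c b) :
    minErr τ d b f = ENNReal.ofReal (seqInner b c).re := by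
  have hm := (hasSeries_solutionFun hf hb hsum).memLp.1
  rw [hc.unique hτ hf hmin (toeplitzMaps_solutionSeq hτ hf hmin hb hsum),
    seqInner_solutionSeq hτ hf hmin hb hsum, minErr_eq_err_hTau hτ hf hmin hb hm .rfl,
    err_hTau hτ hf hmin hb .rfl, enorm_sq_eq_ofReal]

end

section

variable {K : Set ℕ+} {τ d : ℕ} {f f₀ : ℝ → Vec K →L[ℂ] Vec K}

/-! ### Convex combinations of spectral densities -/

/-- The convex combination `(1 - t) f₀ + t f`. -/
def mix (t : ℝ) (f₀ f : ℝ → Vec K →L[ℂ] Vec K) (x : ℝ) : Vec K →L[ℂ] Vec K :=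
  ((1 - t : ℝ) : ℂ) • f₀ x + (t : ℂ) • f x

lemma mix_mem {D : Set (ℝ → Vec K →L[ℂ] Vec K)} (hD : Convex ℝ D) (h₀ : f₀ ∈ D) (h : f ∈ D)
    {t : ℝ} (ht0 : 0 ≤ t) (ht1 : t ≤ 1) : mix t f₀ f ∈ D := by
  have := hD h₀ h (sub_nonneg.2 ht1) ht0 (by ring)
  convert this using 1
  funext x
  ext1 v
  rw [mix, Pi.add_apply, Pi.smul_apply, Pi.smul_apply, add_apply, add_apply, smul_apply, smul_apply,
    smul_apply, smul_apply, RCLike.real_smul_eq_coe_smul (K := ℂ),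
    RCLike.real_smul_eq_coe_smul (K := ℂ)]
  rfl

lemma re_inner_smul (r : ℝ) (S : Vec K →L[ℂ] Vec K) (u v : Vec K) :
    (inner ℂ u (((r : ℂ) • S) v)).re = r * (inner ℂ u (S v)).re := by
  rw [smul_apply, inner_smul_right, Complex.re_ofReal_mul]

lemma re_inner_mix (t : ℝ) (x : ℝ) (u v : Vec K) :
    (inner ℂ u (mix t f₀ f x v)).re =
      (1 - t) * (inner ℂ u (f₀ x v)).re + t * (inner ℂ u (f x v)).re := by
  rw [mix, add_apply, inner_add_right, Complex.add_re, re_inner_smul, re_inner_smul]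

lemma isPositive_smul {S : Vec K →L[ℂ] Vec K} (hS : S.IsPositive) {r : ℝ} (hr : 0 ≤ r) :
    ((r : ℂ) • S).IsPositive :=
  hS.smul_of_nonneg (by exact_mod_cast hr)

lemma ringInverse_smul {S : Vec K →L[ℂ] Vec K} (hS : IsUnit S) {r : ℂ} (hr : r ≠ 0) :
    Ring.inverse (r • S) = r⁻¹ • Ring.inverse S := by
  have h1 : (r • S) * (r⁻¹ • Ring.inverse S) = 1 := by
    rw [smul_mul_smul_comm, mul_inv_cancel₀ hr, Ring.mul_inverse_cancel _ hS, one_smul]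
  have h2 : IsUnit (r • S) := hS.smul (Units.mk0 r hr)
  calc Ring.inverse (r • S) = Ring.inverse (r • S) * ((r • S) * (r⁻¹ • Ring.inverse S)) := by
        rw [h1, mul_one]
    _ = r⁻¹ • Ring.inverse S := by rw [← mul_assoc, Ring.inverse_mul_cancel _ h2, one_mul]

/-- Mixing with a density that satisfies the minimality condition preserves this condition. -/
theorem minimality_mix (hf₀ : IsSpectralDensity τ d f₀) (hmin : Minimality τ d f₀)
    (hf : IsSpectralDensity τ d f) {t : ℝ} (ht0 : 0 ≤ t) (ht1 : t < 1) :
    Minimality τ d (mix t f₀ f) := by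
  have ht : 0 < 1 - t := sub_pos.2 ht1
  have htc : ((1 - t : ℝ) : ℂ) ≠ 0 := by exact_mod_cast ht.ne'
  -- The mixture dominates (1 - t) f₀. Hence it is invertible, and its inverse is at most (1 - t)⁻¹
  -- f₀⁻¹.
  have hpt : ∀ᵐ x ∂circ, (((1 - t : ℝ) : ℂ) • f₀ x).IsPositive ∧
      IsUnit (((1 - t : ℝ) : ℂ) • f₀ x) ∧
      (mix t f₀ f x - ((1 - t : ℝ) : ℂ) • f₀ x).IsPositive ∧ IsUnit (f₀ x) := by
    filter_upwards [hf₀.positive, hf.positive, hmin.1] with x h1 h2 h3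
    refine ⟨isPositive_smul h1 ht.le, h3.smul (Units.mk0 _ htc), ?_, h3⟩
    rw [mix, add_sub_cancel_left]
    exact isPositive_smul h2 ht0
  refine ⟨?_, ?_⟩
  · filter_upwards [hpt] with x ⟨h1, h2, h3, _⟩
    exact isUnit_of_isPositive_sub h1 h2 h3
  · refine lt_of_le_of_lt (lintegral_mono_ae (g := fun x => ENNReal.ofReal (1 - t)⁻¹ *
      (ENNReal.ofReal (weight τ d x) * trace (Ring.inverse (f₀ x)))) ?_) ?_
    · filter_upwards [hpt] with x ⟨h1, h2, h3, h4⟩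
      rw [mul_left_comm]
      gcongr
      rw [trace, trace, ← ENNReal.tsum_mul_left]
      refine ENNReal.tsum_le_tsum fun k => ?_
      rw [← ENNReal.ofReal_mul (inv_nonneg.2 ht.le)]
      refine ENNReal.ofReal_le_ofReal ?_
      have h5 := (isPositive_inverse_sub_inverse h1 h2 h3).re_inner_nonneg_right (basisVec k)
      rw [sub_apply, inner_sub_right, map_sub, ringInverse_smul h4 htc, ← Complex.ofReal_inv,
        RCLike.re_eq_complex_re, re_inner_smul] at h5
      linarith
    · rw [lintegral_const_mul' _ _ ENNReal.ofReal_ne_top]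
      exact ENNReal.mul_lt_top ENNReal.ofReal_lt_top hmin.2

lemma aestronglyMeasurable_sub_pastComb {b : ℕ → Vec K} (hb : Summable fun j => ‖b j‖)
    (α : K × ℕ →₀ ℂ) {μ : Measure ℝ} :
    AEStronglyMeasurable (fun x => chi τ d x • Bfun b x - pastComb τ d α x) μ :=
  ((measurable_chi τ d).aestronglyMeasurable.smul
    (continuous_Bfun hb).aestronglyMeasurable).sub (aestronglyMeasurable_pastComb α)

variable [Finite K]

lemma sqNorm_mix (hf₀ : IsSpectralDensity τ d f₀) (hf : IsSpectralDensity τ d f) {t : ℝ}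
    (ht0 : 0 ≤ t) (ht1 : t ≤ 1) {g : ℝ → Vec K} (hg : AEStronglyMeasurable g circ) :
    sqNorm (mix t f₀ f) g = ENNReal.ofReal (1 - t) * sqNorm f₀ g + ENNReal.ofReal t * sqNorm f g := by
  have hm : AEMeasurable (fun x => ENNReal.ofReal (inner ℂ (g x) (f₀ x (g x))).re) circ :=
    (Complex.measurable_re.comp_aemeasurable (hg.inner (𝕜 := ℂ) (aestronglyMeasurable_apply
      (aestronglyMeasurable_clm hf₀.measurable) hg)).aemeasurable).ennreal_ofReal
  have h : ∫⁻ x, ENNReal.ofReal (inner ℂ (g x) (mix t f₀ f x (g x))).re ∂circ =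
      ENNReal.ofReal (1 - t) * ∫⁻ x, ENNReal.ofReal (inner ℂ (g x) (f₀ x (g x))).re ∂circ +
      ENNReal.ofReal t * ∫⁻ x, ENNReal.ofReal (inner ℂ (g x) (f x (g x))).re ∂circ := by
    rw [← lintegral_const_mul' _ _ ENNReal.ofReal_ne_top,
      ← lintegral_const_mul' _ _ ENNReal.ofReal_ne_top, ← lintegral_add_left' (hm.const_mul _)]
    refine lintegral_congr_ae ?_
    filter_upwards [hf₀.positive, hf.positive] with x h1 h2
    have h3 : 0 ≤ (inner ℂ (g x) (f₀ x (g x))).re := h1.re_inner_nonneg_right (g x)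
    have h4 : 0 ≤ (inner ℂ (g x) (f x (g x))).re := h2.re_inner_nonneg_right (g x)
    rw [re_inner_mix, ENNReal.ofReal_add (mul_nonneg (sub_nonneg.2 ht1) h3) (mul_nonneg ht0 h4),
      ENNReal.ofReal_mul (sub_nonneg.2 ht1), ENNReal.ofReal_mul ht0]
  rw [sqNorm, h, sqNorm, sqNorm]
  ring

/-- The squared norm is affine in the density. Finite combinations of the past are the useful
estimates here, being admissible for all densities at once. -/
lemma err_mix (hf₀ : IsSpectralDensity τ d f₀) (hf : IsSpectralDensity τ d f) {t : ℝ}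
    (ht0 : 0 ≤ t) (ht1 : t ≤ 1) {b : ℕ → Vec K} (hb : Summable fun j => ‖b j‖)
    (α : K × ℕ →₀ ℂ) : err τ d b (pastComb τ d α) (mix t f₀ f) =
      ENNReal.ofReal (1 - t) * err τ d b (pastComb τ d α) f₀ +
        ENNReal.ofReal t * err τ d b (pastComb τ d α) f :=
  sqNorm_mix hf₀ hf ht0 ht1 (aestronglyMeasurable_sub_pastComb hb α)

/-! ### Least favourable densities and minimax characteristics -/

section Extremal

variable {b : ℕ → Vec K} {D : Set (ℝ → Vec K →L[ℂ] Vec K)}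

/-- Maximality over the densities with the minimality condition extends to a convex class. -/
theorem minErr_le_of_convex (hb : Summable fun j => ‖b j‖)
    (hD : ∀ f ∈ D, IsSpectralDensity τ d f) (hconv : Convex ℝ D) (h₀ : f₀ ∈ D)
    (hmin : Minimality τ d f₀) (hfin : minErr τ d b f₀ ≠ ⊤)
    (hmax : ∀ f ∈ D, Minimality τ d f → minErr τ d b f ≤ minErr τ d b f₀) (hf : f ∈ D) :
    minErr τ d b f ≤ minErr τ d b f₀ := by
  have hm : mix (1 / 2) f₀ f ∈ D := mix_mem hconv h₀ hf (by norm_num) (by norm_num)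
  have h1 := hmax _ hm (minimality_mix (hD _ h₀) hmin (hD _ hf) (by norm_num) (by norm_num))
  -- Concavity of Δ at the midpoint. The midpoint satisfies minimality, so its value is at most
  -- Δ(f₀), and half of the finite Δ(f₀) can be cancelled.
  have h2 : ENNReal.ofReal (1 / 2) * minErr τ d b f₀ + ENNReal.ofReal (1 / 2) * minErr τ d b f ≤
      minErr τ d b (mix (1 / 2) f₀ f) := by
    rw [minErr_eq_iInf_pastComb (hD _ hm) hb]
    refine le_iInf fun α => ?_
    rw [err_mix (hD _ h₀) (hD _ hf) (by norm_num) (by norm_num) hb]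
    gcongr
    · norm_num
    · exact iInf₂_le _ (pastComb_mem_L2Past _ α)
    · exact iInf₂_le _ (pastComb_mem_L2Past _ α)
  have h3 := h2.trans h1
  have hhalf : ENNReal.ofReal (1 / 2) * minErr τ d b f₀ + ENNReal.ofReal (1 / 2) * minErr τ d b f₀ =
      minErr τ d b f₀ := by
    rw [← add_mul, ← ENNReal.ofReal_add (by norm_num) (by norm_num)]
    norm_num
  conv_rhs at h3 => rw [← hhalf]
  rw [ENNReal.add_le_add_iff_left (ENNReal.mul_ne_top ENNReal.ofReal_ne_top hfin)] at h3
  exact (ENNReal.mul_le_mul_iff_right (by norm_num) ENNReal.ofReal_ne_top).1 h3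

/-- Here M stands for Δ(f₀), s for the squared distance of an estimate from h_τ(f₀) in L_2(f₀), and
e for its error at f. Dropping s and dividing by t bounds e, where the slack t² leaves only t.
Dropping te and dividing by 1 - t ≥ 1/2 bounds s. -/
lemma err_bounds {M s e t : ENNReal} {r : ℝ} (hM : M ≠ ⊤) (hr0 : 0 < r) (hr1 : r ≤ 1 / 2)
    (ht : t = ENNReal.ofReal r)
    (h : ENNReal.ofReal (1 - r) * (M + s) + t * e < M + t ^ 2) :
    e ≤ M + t ∧ s ≤ 2 * (t * M + t ^ 2) := by
  subst ht
  have hfin := h.trans (ENNReal.add_lt_top.2 ⟨hM.lt_top, ENNReal.pow_lt_top ENNReal.ofReal_lt_top⟩)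
  have h1r : 0 < 1 - r := by linarith
  have hs : s ≠ ⊤ := by
    rintro rfl
    rw [add_top, ENNReal.mul_top (by simpa using h1r), top_add] at hfin
    exact lt_irrefl _ hfin
  have he : e ≠ ⊤ := by
    rintro rfl
    rw [ENNReal.mul_top (by simpa using hr0), add_top] at hfin
    exact lt_irrefl _ hfin
  lift M to NNReal using hM
  lift s to NNReal using hs
  lift e to NNReal using he
  obtain ⟨q, hq⟩ : ∃ q : NNReal, (q : ℝ) = r := ⟨⟨r, hr0.le⟩, rfl⟩
  obtain ⟨p, hp⟩ : ∃ p : NNReal, (p : ℝ) = 1 - r := ⟨⟨1 - r, h1r.le⟩, rfl⟩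
  rw [← hp, ← hq, ENNReal.ofReal_coe_nnreal, ENNReal.ofReal_coe_nnreal] at h
  rw [← hq, ENNReal.ofReal_coe_nnreal]
  norm_cast at h ⊢
  have h' : (p : ℝ) * (M + s) + q * e < M + q ^ 2 := by exact_mod_cast h
  rw [← NNReal.coe_le_coe, ← NNReal.coe_le_coe]
  push_cast
  rw [hp] at h'
  have hs0 := s.coe_nonneg
  have he0 := e.coe_nonneg
  have hM0 := M.coe_nonneg
  rw [hq] at h' ⊢
  refine ⟨?_, ?_⟩
  · have : r * e ≤ r * (M + r) := by nlinarith
    exact le_of_mul_le_mul_left this hr0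
  · nlinarith [mul_nonneg hr0.le he0]

/-- If `f₀` is least favourable in a convex class, the errors of its optimal characteristic are
maximal at `f₀`. -/
theorem err_hTau_le_of_convex (hτ : 0 < τ) (hb : Summable fun j => ‖b j‖)
    (hD : ∀ f ∈ D, IsSpectralDensity τ d f) (hconv : Convex ℝ D) (h₀ : f₀ ∈ D)
    (hmin : Minimality τ d f₀) {C : ℝ → Vec K}
    (hCm : AEStronglyMeasurable C circ) (hC : C =ᵐ[circ] solutionFun (hD f₀ h₀) hb)
    (hmax : ∀ f ∈ D, minErr τ d b f ≤ minErr τ d b f₀) (hf : f ∈ D) :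
    err τ d b (hTau τ d b f₀ C) f ≤ minErr τ d b f₀ := by
  set h := hTau τ d b f₀ C with hh
  set M := minErr τ d b f₀ with hM
  have hMe : M = err τ d b h f₀ := minErr_eq_err_hTau hτ (hD _ h₀) hmin hb hCm hC
  have hMtop : M ≠ ⊤ := by
    rw [hMe, err_hTau hτ (hD _ h₀) hmin hb hC]
    exact (ENNReal.pow_lt_top enorm_lt_top).ne
  set r : ℕ → ℝ := fun n => 1 / ((n : ℝ) + 2) with hr
  have hr0 : ∀ n, 0 < r n := fun n => by positivity
  have hr1 : ∀ n, r n ≤ 1 / 2 := fun n =>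
    one_div_le_one_div_of_le two_pos (by have := n.cast_nonneg (α := ℝ); linarith)
  have hrlim : Tendsto (fun n => ENNReal.ofReal (r n)) atTop (𝓝 0) := by
    have : Tendsto r atTop (𝓝 0) := by
      have h1 := tendsto_one_div_add_atTop_nhds_zero_nat (𝕜 := ℝ)
      refine (h1.comp (tendsto_add_atTop_nat 1)).congr fun n => ?_
      simp only [hr, Function.comp_apply]
      push_cast; ring_nf
    simpa using ENNReal.tendsto_ofReal this
  -- Take a combination whose error for the mixture with weight r n is within (r n)² of Δ(f₀); this
  -- is possible because f₀ is least favourable. Pythagoras at f₀ splits its error into Δ(f₀) and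
  -- the distance from h.
  have hex : ∀ n, ∃ α : K × ℕ →₀ ℂ,
      err τ d b (pastComb τ d α) f ≤ M + ENNReal.ofReal (r n) ∧
      sqNorm f₀ (fun x => h x - pastComb τ d α x) ≤
        2 * (ENNReal.ofReal (r n) * M + ENNReal.ofReal (r n) ^ 2) := by
    intro n
    have hm : mix (r n) f₀ f ∈ D := mix_mem hconv h₀ hf (hr0 n).le (by linarith [hr1 n])
    have h1 : minErr τ d b (mix (r n) f₀ f) < M + ENNReal.ofReal (r n) ^ 2 :=
      (hmax _ hm).trans_lt (ENNReal.lt_add_right hMtop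
        (pow_ne_zero _ (by simpa using hr0 n)))
    rw [minErr_eq_iInf_pastComb (hD _ hm) hb, iInf_lt_iff] at h1
    obtain ⟨α, hα⟩ := h1
    rw [err_mix (hD _ h₀) (hD _ hf) (hr0 n).le (by linarith [hr1 n]) hb,
      err_pastComb hτ (hD _ h₀) hmin hb hC, ← hh, ← hMe] at hα
    exact ⟨α, err_bounds hMtop (hr0 n) (hr1 n) rfl hα⟩
  choose α hα1 hα2 using hex
  have hA₀ : AEStronglyMeasurable (sqrtDensity f₀) circN :=
    aestronglyMeasurable_circN.2 (aestronglyMeasurable_sqrtDensity (hD _ h₀))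
  have hA : AEStronglyMeasurable (sqrtDensity f) circN :=
    aestronglyMeasurable_circN.2 (aestronglyMeasurable_sqrtDensity (hD _ hf))
  have hhm : AEStronglyMeasurable h circN :=
    aestronglyMeasurable_circN.2 (aestronglyMeasurable_hTau (hD _ h₀) hb hCm)
  have hlim : Tendsto (fun n => eLpNorm ((fun x => sqrtDensity f₀ x (h x - pastComb τ d (α n) x)) -
      fun _ => 0) 2 circN) atTop (𝓝 0) := by
    have h1 : Tendsto (fun n => 2 * (ENNReal.ofReal (r n) * M + ENNReal.ofReal (r n) ^ 2))
        atTop (𝓝 0) := by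
      have h2 := ENNReal.Tendsto.const_mul (a := 2) ((ENNReal.Tendsto.mul_const (b := M) hrlim
        (Or.inr hMtop)).add ((ENNReal.continuous_pow 2).continuousAt.tendsto.comp hrlim))
        (Or.inr ENNReal.ofNat_ne_top)
      simpa using h2
    have h2 : Tendsto (fun n => eLpNorm (fun x => sqrtDensity f₀ x (h x - pastComb τ d (α n) x)) 2
        circN ^ 2) atTop (𝓝 0) := by
      refine tendsto_of_tendsto_of_tendsto_of_le_of_le tendsto_const_nhds h1 (fun _ => zero_le)
        fun n => ?_
      have := hα2 n
      rwa [sqNorm_eq_eLpNorm_sq (hD _ h₀).positive] at this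
    have h3 := (ENNReal.continuous_rpow_const (y := 1 / 2)).continuousAt.tendsto.comp h2
    rw [ENNReal.zero_rpow_of_pos (by norm_num)] at h3
    refine h3.congr fun n => ?_
    rw [Function.comp_apply, ← ENNReal.rpow_natCast, ← ENNReal.rpow_mul]
    norm_num
    congr 1
    funext x
    exact (sub_zero _).symm
  obtain ⟨ns, hns, hae⟩ := (tendstoInMeasure_of_tendsto_eLpNorm two_ne_zero
    (fun n => aestronglyMeasurable_apply hA₀ (hhm.sub (aestronglyMeasurable_pastComb (α n))))
    aestronglyMeasurable_const hlim).exists_seq_tendsto_ae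
  -- Invertibility of f₀ almost everywhere removes the weight f₀^{1/2}, so the combinations
  -- themselves converge pointwise to h. The convergence can then be read with the weight of f, and
  -- Fatou's lemma applies.
  have hconvae : ∀ᵐ x ∂circN, Tendsto (fun i => ‖sqrtDensity f x (chi τ d x • Bfun b x -
      pastComb τ d (α (ns i)) x)‖ₑ ^ 2) atTop
      (𝓝 (‖sqrtDensity f x (chi τ d x • Bfun b x - h x)‖ₑ ^ 2)) := by
    filter_upwards [hae, ae_regular hτ (hD _ h₀) hmin] with x h1 ⟨h2, h3, _⟩
    obtain ⟨u, hu⟩ := isUnit_sqrtDensity h2 h3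
    have h4 := ((↑u⁻¹ : Vec K →L[ℂ] Vec K).continuous.tendsto _).comp h1
    have h5 : Tendsto (fun i => h x - pastComb τ d (α (ns i)) x) atTop (𝓝 0) := by
      rw [map_zero] at h4
      refine h4.congr fun i => ?_
      rw [Function.comp_apply, ← hu, ← clm_mul_apply, Units.inv_mul]
      rfl
    have h6 : Tendsto (fun i => chi τ d x • Bfun b x - pastComb τ d (α (ns i)) x) atTop
        (𝓝 (chi τ d x • Bfun b x - h x)) := by
      have := h5.const_add (chi τ d x • Bfun b x - h x)
      simpa using this
    exact (ENNReal.continuous_pow 2).continuousAt.tendsto.comp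
      (((sqrtDensity f x).continuous.tendsto _).comp h6).enorm
  rw [err, sqNorm_eq (hD _ hf).positive]
  calc ∫⁻ x, ‖sqrtDensity f x (chi τ d x • Bfun b x - h x)‖ₑ ^ 2 ∂circN
      = ∫⁻ x, liminf (fun i => ‖sqrtDensity f x (chi τ d x • Bfun b x -
          pastComb τ d (α (ns i)) x)‖ₑ ^ 2) atTop ∂circN := by
        refine lintegral_congr_ae ?_
        filter_upwards [hconvae] with x hx
        exact hx.liminf_eq.symm
    _ ≤ liminf (fun i => ∫⁻ x, ‖sqrtDensity f x (chi τ d x • Bfun b x -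
          pastComb τ d (α (ns i)) x)‖ₑ ^ 2 ∂circN) atTop :=
        lintegral_liminf_le' fun i => (aestronglyMeasurable_apply hA
          (aestronglyMeasurable_sub_pastComb hb _)).enorm.pow_const 2
    _ ≤ liminf (fun i => M + ENNReal.ofReal (r (ns i))) atTop := by
        refine liminf_le_liminf (.of_forall fun i => ?_)
        rw [← sqNorm_eq (hD _ hf).positive]
        exact hα1 (ns i)
    _ = M := by
        have h1 := (hrlim.comp hns.tendsto_atTop).const_add M
        rw [add_zero] at h1
        exact h1.liminf_eq

end Extremal

end

section

variable {K : Set ℕ+} {τ d : ℕ} {f : ℝ → Vec K →L[ℂ] Vec K}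

/-! ### Two families with the same Gram matrix -/

/-- The norm of a combination depends only on the Gram matrix. This transfers distances between
L²(P) and the spectral space. -/
lemma norm_linearCombination_eq {ι H H' : Type*} [NormedAddCommGroup H] [InnerProductSpace ℂ H]
    [NormedAddCommGroup H'] [InnerProductSpace ℂ H'] {x : ι → H} {y : ι → H'}
    (h : ∀ i j, inner ℂ (x i) (x j) = inner ℂ (y i) (y j)) (β : ι →₀ ℂ) :
    ‖Finsupp.linearCombination ℂ x β‖ = ‖Finsupp.linearCombination ℂ y β‖ := by
  have h2 : inner ℂ (Finsupp.linearCombination ℂ x β) (Finsupp.linearCombination ℂ x β) =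
      inner ℂ (Finsupp.linearCombination ℂ y β) (Finsupp.linearCombination ℂ y β) := by
    simp only [Finsupp.linearCombination_apply, Finsupp.sum, sum_inner, inner_sum, inner_smul_left,
      inner_smul_right, h]
  rw [inner_self_eq_norm_sq_to_K, inner_self_eq_norm_sq_to_K] at h2
  have h3 : ‖Finsupp.linearCombination ℂ x β‖ ^ 2 = ‖Finsupp.linearCombination ℂ y β‖ ^ 2 :=
    Complex.ofReal_injective (by push_cast; exact h2)
  exact (sq_eq_sq₀ (norm_nonneg _) (norm_nonneg _)).1 h3

/-! ### The components of the increments are square integrable -/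

lemma sq_lintegral_enorm_le {X : Type*} [MeasurableSpace X] {μ : Measure X} {g : X → ℂ}
    (hg : AEStronglyMeasurable g μ) :
    (∫⁻ x, ‖g x‖ₑ ∂μ) ^ 2 ≤ μ Set.univ * ∫⁻ x, ‖g x‖ₑ ^ 2 ∂μ := by
  have h := eLpNorm_le_eLpNorm_mul_rpow_measure_univ (μ := μ) (f := g) (p := 1) (q := 2)
    one_le_two hg
  have h2 := eLpNorm_nnreal_pow_eq_lintegral (f := g) (μ := μ) (p := 2) two_ne_zero
  rw [eLpNorm_one_eq_lintegral_enorm] at h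
  refine (pow_le_pow_left' h 2).trans (le_of_eq ?_)
  rw [mul_pow, mul_comm]
  congr 1
  · rw [← ENNReal.rpow_natCast, ← ENNReal.rpow_mul]
    norm_num
  · simpa using h2

/-- The coefficients of the partial sums of `B ξ`. -/
def partialCoeff [Fintype K] (b : ℕ → Vec K) (N : ℕ) : K × ℤ →₀ ℂ :=
  ∑ j ∈ Finset.range N, ∑ k : K, Finsupp.single (k, (j : ℤ)) (b j k)

lemma linearCombination_partialCoeff [Fintype K] {H : Type*} [AddCommGroup H] [Module ℂ H]
    (x : K × ℤ → H) (b : ℕ → Vec K) (N : ℕ) :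
    Finsupp.linearCombination ℂ x (partialCoeff b N) =
      ∑ j ∈ Finset.range N, ∑ k : K, b j k • x (k, (j : ℤ)) := by
  simp only [partialCoeff, map_sum, Finsupp.linearCombination_single]

section Components

variable {Ω : Type*} [MeasurableSpace Ω] {P : Measure Ω} {T : ℝ}
  {ξ : ℝ → Ω → ℂ}

lemma measurable_uncurry_increment (hξ : Measurable (Function.uncurry ξ)) (d : ℕ) (s : ℝ) :
    Measurable (Function.uncurry (increment d s ξ)) := by
  have h : ∀ l : ℕ, Measurable fun q : ℝ × Ω => ξ (q.1 - l * s) q.2 := fun l =>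
    hξ.comp ((measurable_fst.sub_const _).prodMk measurable_snd)
  have h2 : Measurable fun q : ℝ × Ω => ∑ l ∈ Finset.range (d + 1),
      (-1) ^ l * (d.choose l : ℂ) * ξ (q.1 - l * s) q.2 :=
    Finset.measurable_fun_sum _ fun l _ => (h l).const_mul _
  exact h2

/-- The kernel is unimodular, so Cauchy–Schwarz over one period bounds the squared integral by T
times the integrated squared increment, which has finite expectation. -/
lemma memLp_component (hT : 0 < T) (hξ : HasSpectralDensity P T τ d ξ f) (k : ℕ+) (j : ℤ) :
    MemLp (component T τ d ξ k j) 2 P := by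
  set g : Ω → ℝ → ℂ := fun ω u => increment d (τ * T) ξ (u + j * T) ω *
    Complex.exp (-(2 * Real.pi * Complex.I * (freq k : ℤ) * u / T)) with hg
  have hinc : Measurable (Function.uncurry fun (ω : Ω) (u : ℝ) =>
      increment d (τ * T) ξ (u + j * T) ω) :=
    (measurable_uncurry_increment hξ.measurable d (τ * T)).comp
      ((measurable_snd.add_const _).prodMk measurable_fst)
  have hgm : Measurable (Function.uncurry g) := by
    refine hinc.mul ?_
    have : Measurable fun u : ℝ =>
        Complex.exp (-(2 * Real.pi * Complex.I * (freq k : ℤ) * u / T)) := by fun_prop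
    exact this.comp measurable_snd
  have hnorm : ∀ ω u, ‖g ω u‖ₑ = ‖increment d (τ * T) ξ (u + j * T) ω‖ₑ := by
    intro ω u
    have h1 : -(2 * Real.pi * Complex.I * (freq k : ℤ) * u / T) =
        ((-(2 * Real.pi * (freq k : ℤ) * u / T) : ℝ) : ℂ) * Complex.I := by push_cast; ring
    simp only [hg]
    rw [enorm_mul, h1, ← ofReal_norm (Complex.exp _), Complex.norm_exp_ofReal_mul_I]
    simp
  have hcomp : component T τ d ξ k j =
      fun ω => ((1 / Real.sqrt T : ℝ) : ℂ) * ∫ u in Set.Ioc 0 T, g ω u := by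
    funext ω
    rw [component, blockCoeff, intervalIntegral.integral_of_le hT.le]
  have hsm : StronglyMeasurable fun ω => ∫ u in Set.Ioc 0 T, g ω u :=
    StronglyMeasurable.integral_prod_right hgm.stronglyMeasurable
  have hmem : MemLp (fun ω => ∫ u in Set.Ioc 0 T, g ω u) 2 P := by
    refine ⟨hsm.aestronglyMeasurable, ?_⟩
    rw [eLpNorm_lt_top_iff_lintegral_rpow_enorm_lt_top (by norm_num) (by norm_num)]
    simp only [ENNReal.toReal_ofNat, ENNReal.rpow_ofNat]
    refine lt_of_le_of_lt (lintegral_mono (g := fun ω => ENNReal.ofReal T *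
      ∫⁻ u in Set.Ico 0 T, ‖increment d (τ * T) ξ (u + j * T) ω‖ₑ ^ 2) fun ω => ?_) ?_
    · have h1 := sq_lintegral_enorm_le (μ := volume.restrict (Set.Ioc 0 T))
        (hgm.of_uncurry_left (x := ω)).aestronglyMeasurable
      refine (pow_le_pow_left' (enorm_integral_le_lintegral_enorm _) 2).trans (h1.trans_eq ?_)
      rw [Measure.restrict_apply_univ, Real.volume_Ioc, sub_zero,
        restrict_Ico_eq_restrict_Ioc]
      simp only [hnorm]
    · rw [lintegral_const_mul' _ _ ENNReal.ofReal_ne_top]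
      exact ENNReal.mul_lt_top ENNReal.ofReal_lt_top (hξ.sq_integrable j)
  rw [hcomp]
  exact hmem.const_mul _

/-- The components of the increments as elements of `L²(P)`. -/
def compLp (hT : 0 < T) (hξ : HasSpectralDensity P T τ d ξ f) (p : K × ℤ) : Lp ℂ 2 P :=
  (memLp_component hT hξ p.1 p.2).toLp _

lemma coeFn_compLp (hT : 0 < T) (hξ : HasSpectralDensity P T τ d ξ f) (p : K × ℤ) :
    ∀ᵐ ω ∂P, compLp hT hξ p ω = component T τ d ξ p.1 p.2 ω :=
  MemLp.coeFn_toLp _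

/-! ### Correspondence between the process and the spectral model -/

variable [Finite K]

/-- The correspondence between the components of the increments and the functions
`e^{ijx} R δ_k` preserves inner products. -/
lemma inner_compLp (hT : 0 < T) (hf : IsSpectralDensity τ d f)
    (hξ : HasSpectralDensity P T τ d ξ f) (p q : K × ℤ) :
    inner ℂ (compLp hT hξ p) (compLp hT hξ q) =
      inner ℂ (symVec hf p.2 (basisVec p.1)) (symVec hf q.2 (basisVec q.1)) := by
  have h1 : inner ℂ (compLp hT hξ p) (compLp hT hξ q) =
      ∫ ω, component T τ d ξ q.1 q.2 ω * (starRingEnd ℂ) (component T τ d ξ p.1 p.2 ω) ∂P := by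
    rw [L2.inner_def]
    refine integral_congr_ae ?_
    filter_upwards [coeFn_compLp hT hξ p, coeFn_compLp hT hξ q] with ω h1 h2
    rw [h1, h2, RCLike.inner_apply]
  rw [h1, hξ.covariance, L2.inner_def, integral_circN, smul_eq_mul]
  congr 1
  rw [← integral_congr_ae]
  filter_upwards [hf.positive, ae_circN ▸ coeFn_symVec hf p.2 (basisVec p.1),
    ae_circN ▸ coeFn_symVec hf q.2 (basisVec q.1)] with x h2 h3 h4
  rw [h3, h4, inner_smul_left, inner_smul_right, conj_unimod, rootSymbol, smul_apply, smul_apply,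
    inner_smul_left, inner_smul_right, ← inner_apply_eq h2]
  have h5 : Complex.exp (Complex.I * x * ((q.2 : ℂ) - p.2)) = unimod (-p.2) x * unimod q.2 x := by
    rw [← unimod_add, unimod]
    congr 1; push_cast; ring
  have h6 : (((‖chi τ d x‖ ^ 2 : ℝ)) : ℂ) = (starRingEnd ℂ) (chi τ d x) * chi τ d x := by
    rw [mul_comm, Complex.mul_conj, Complex.normSq_eq_norm_sq]
  rw [h5, h6]
  ring

/-- Multiplication by e^{ijx} is isometric, so the norm does not depend on j. This uniform bound
makes the series for Bξ absolutely convergent. -/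
lemma norm_compLp (hT : 0 < T) (hf : IsSpectralDensity τ d f)
    (hξ : HasSpectralDensity P T τ d ξ f) (k : K) (j : ℤ) :
    ‖compLp hT hξ (k, j)‖ = ‖symVec hf 0 (basisVec k)‖ := by
  have h := inner_compLp hT hf hξ (k, j) (k, j)
  rw [inner_self_eq_norm_sq_to_K, inner_self_eq_norm_sq_to_K] at h
  have h3 : ‖compLp hT hξ (k, j)‖ ^ 2 = ‖symVec hf j (basisVec k)‖ ^ 2 :=
    Complex.ofReal_injective (by push_cast; exact h)
  rw [(sq_eq_sq₀ (norm_nonneg _) (norm_nonneg _)).1 h3, ← LinearIsometry.norm_map (rot j)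
    (symVec hf 0 (basisVec k)), rot_symVec, add_zero]

/-- Almost surely, the series that defines `B ξ` converges. -/
lemma ae_tendsto_functionalB [IsProbabilityMeasure P] [Fintype K] (hT : 0 < T) (hf : IsSpectralDensity τ d f)
    (hξ : HasSpectralDensity P T τ d ξ f) {b : ℕ → Vec K} (hb : Summable fun j => ‖b j‖) :
    ∀ᵐ ω ∂P, Tendsto (fun N => ∑ j ∈ Finset.range N, ∑ k : K,
      b j k * component T τ d ξ k j ω) atTop (𝓝 (functionalB T τ d b ξ ω)) := by
  have hm : ∀ (j : ℕ) (k : K), AEMeasurable (fun ω => ‖b j k * component T τ d ξ k j ω‖ₑ) P :=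
    fun j k => ((memLp_component hT hξ k j).1.const_mul (b j k)).enorm
  set S : ℝ := ∑ k : K, ‖symVec hf 0 (basisVec k)‖ with hS
  -- On a probability space the L¹ norms of the components are at most their L² norms, which are
  -- independent of j; summability of ‖b_j‖ then makes the expected absolute sum finite.
  have hfin : ∫⁻ ω, ∑' j : ℕ, ∑ k : K, ‖b j k * component T τ d ξ k j ω‖ₑ ∂P ≠ ⊤ := by
    rw [lintegral_tsum fun j => Finset.aemeasurable_fun_sum _ fun k _ => hm j k]
    have hle : ∀ j : ℕ, ∫⁻ ω, ∑ k : K, ‖b j k * component T τ d ξ k j ω‖ₑ ∂P ≤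
        ENNReal.ofReal (‖b j‖ * S) := by
      intro j
      rw [lintegral_finsetSum' _ fun k _ => hm j k, hS, Finset.mul_sum,
        ENNReal.ofReal_sum_of_nonneg fun _ _ => by positivity]
      refine Finset.sum_le_sum fun k _ => ?_
      simp only [enorm_mul]
      rw [lintegral_const_mul' _ _ enorm_ne_top, ENNReal.ofReal_mul (norm_nonneg _), ofReal_norm,
        ofReal_norm]
      gcongr
      · rw [← ofReal_norm, ← ofReal_norm]
        exact ENNReal.ofReal_le_ofReal (lp.norm_apply_le_norm two_ne_zero _ _)
      · rw [← eLpNorm_one_eq_lintegral_enorm, ← ofReal_norm, ← norm_compLp hT hf hξ k j,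
          ofReal_norm, Lp.enorm_def, eLpNorm_congr_ae (coeFn_compLp hT hξ (k, (j : ℤ)))]
        exact eLpNorm_le_eLpNorm_of_exponent_le one_le_two (memLp_component hT hξ k j).1
    refine ((ENNReal.tsum_le_tsum hle).trans_lt ?_).ne
    rw [← ENNReal.ofReal_tsum_of_nonneg (fun j => by positivity) (hb.mul_right S)]
    exact ENNReal.ofReal_lt_top
  filter_upwards [ae_lt_top' (AEMeasurable.tsum fun j =>
    Finset.aemeasurable_fun_sum _ fun k _ => hm j k) hfin] with ω hω
  have hsum : Summable fun j : ℕ => ∑ k : K, b j k * component T τ d ξ k j ω := by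
    refine Summable.of_enorm ((lt_of_le_of_lt (ENNReal.tsum_le_tsum fun j => ?_) hω).ne)
    exact enorm_sum_le _ _
  have h := hsum.hasSum.tendsto_sum_nat
  simpa only [functionalB, tsum_fintype] using h

/-- `Δ(f)` is the mean square error of the optimal linear estimate. -/
theorem extrapolationError_eq_minErr [IsProbabilityMeasure P] (hT : 0 < T) (hf : IsSpectralDensity τ d f)
    (hξ : HasSpectralDensity P T τ d ξ f) {b : ℕ → Vec K} (hb : Summable fun j => ‖b j‖) :
    extrapolationError P T τ d b ξ = minErr τ d b f := by
  have := Fintype.ofFinite K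
  set x : K × ℤ → Lp ℂ 2 P := compLp hT hξ with hx
  set y : K × ℤ → Lp (Vec K) 2 circN := fun p => symVec hf p.2 (basisVec p.1) with hy
  have hxy : ∀ β : K × ℤ →₀ ℂ,
      ‖Finsupp.linearCombination ℂ x β‖ = ‖Finsupp.linearCombination ℂ y β‖ :=
    norm_linearCombination_eq (inner_compLp hT hf hξ)
  have hylim : Tendsto (fun N => Finsupp.linearCombination ℂ y (partialCoeff b N)) atTop
      (𝓝 (targetLp hf hb)) := by
    refine (tendsto_sum_symVec hf hb).congr fun N => ?_
    rw [linearCombination_partialCoeff]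
    exact Finset.sum_congr rfl fun j _ => symVec_eq_sum hf j (b j)
  -- The spectral partial sums converge, and the partial sums of the process have the same mutual
  -- distances, so they are Cauchy.
  obtain ⟨Y, hY⟩ : ∃ Y, Tendsto (fun N => Finsupp.linearCombination ℂ x (partialCoeff b N)) atTop
      (𝓝 Y) := by
    refine cauchySeq_tendsto_of_complete (Metric.cauchySeq_iff.2 fun ε hε => ?_)
    obtain ⟨N, hN⟩ := Metric.cauchySeq_iff.1 hylim.cauchySeq ε hε
    refine ⟨N, fun m hm n hn => ?_⟩
    rw [dist_eq_norm, ← map_sub, hxy, map_sub, ← dist_eq_norm]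
    exact hN m hm n hn
  -- The L² limit and the almost sure sum coincide, since both are limits of the partial sums along
  -- a common subsequence.
  have hYB : ∀ᵐ ω ∂P, Y ω = functionalB T τ d b ξ ω := by
    obtain ⟨ns, hns, hae⟩ := (tendstoInMeasure_of_tendsto_Lp hY).exists_seq_tendsto_ae
    have hcoe : ∀ᵐ ω ∂P, ∀ N, Finsupp.linearCombination ℂ x (partialCoeff b N) ω =
        ∑ j ∈ Finset.range N, ∑ k : K, b j k * component T τ d ξ k j ω := by
      rw [ae_all_iff]
      intro N
      have h1 : ∀ᵐ ω ∂P, ∀ (j : ℕ) (k : K), (b j k • x (k, (j : ℤ)) : Lp ℂ 2 P) ω =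
          b j k * component T τ d ξ k j ω := by
        rw [ae_all_iff]
        intro j
        rw [ae_all_iff]
        intro k
        filter_upwards [Lp.coeFn_smul (b j k) (x (k, (j : ℤ))), coeFn_compLp hT hξ (k, (j : ℤ))]
          with ω h1 h2
        rw [h1, Pi.smul_apply, h2, smul_eq_mul]
      have h2 : ∀ᵐ ω ∂P, ∀ j : ℕ, (∑ k : K, b j k • x (k, (j : ℤ)) : Lp ℂ 2 P) ω =
          ∑ k : K, (b j k • x (k, (j : ℤ)) : Lp ℂ 2 P) ω := by
        rw [ae_all_iff]
        intro j
        filter_upwards [Lp.coeFn_finsetSum Finset.univ fun k : K => b j k • x (k, (j : ℤ))]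
          with ω h
        rw [h, Finset.sum_apply]
      filter_upwards [h1, h2, Lp.coeFn_finsetSum (Finset.range N)
        fun j : ℕ => ∑ k : K, b j k • x (k, (j : ℤ))] with ω h1 h2 h3
      rw [linearCombination_partialCoeff, h3, Finset.sum_apply]
      exact Finset.sum_congr rfl fun j _ => (h2 j).trans (Finset.sum_congr rfl fun k _ => h1 j k)
    filter_upwards [hae, hcoe, ae_tendsto_functionalB hT hf hξ hb] with ω h1 h2 h3
    refine tendsto_nhds_unique h1 ?_
    simp only [h2]
    exact h3.comp hns.tendsto_atTop
  rw [minErr_eq_iInf_pastComb hf hb, extrapolationError]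
  refine iInf_congr fun α => ?_
  set β : K × ℤ →₀ ℂ := α.mapDomain fun p => (p.1, -((p.2 : ℤ) + 1)) with hβ
  have hyβ : Finsupp.linearCombination ℂ y β = pastLp hf α := by
    rw [hβ, Finsupp.linearCombination_mapDomain, pastLp_eq_sum, Finsupp.linearCombination_apply]
    rfl
  have hxβ : ∀ᵐ ω ∂P, Finsupp.linearCombination ℂ x β ω =
      α.sum fun p z => z * component T τ d ξ p.1 (-((p.2 : ℤ) + 1)) ω := by
    have h1 : Finsupp.linearCombination ℂ x β =
        ∑ p ∈ α.support, α p • x (p.1, -((p.2 : ℤ) + 1)) := by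
      rw [hβ, Finsupp.linearCombination_mapDomain, Finsupp.linearCombination_apply]
      rfl
    have h2 : ∀ᵐ ω ∂P, ∀ p : K × ℕ, (α p • x (p.1, -((p.2 : ℤ) + 1)) : Lp ℂ 2 P) ω =
        α p * component T τ d ξ p.1 (-((p.2 : ℤ) + 1)) ω := by
      rw [ae_all_iff]
      intro p
      filter_upwards [Lp.coeFn_smul (α p) (x (p.1, -((p.2 : ℤ) + 1))),
        coeFn_compLp hT hξ (p.1, -((p.2 : ℤ) + 1))] with ω h1 h2
      rw [h1, Pi.smul_apply, h2, smul_eq_mul]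
    filter_upwards [h2, Lp.coeFn_finsetSum α.support
      fun p => α p • x (p.1, -((p.2 : ℤ) + 1))] with ω h2 h3
    rw [h1, h3, Finset.sum_apply]
    exact Finset.sum_congr rfl fun p _ => h2 p
  -- Equality of norms holds for every partial sum minus the combination of the past, and passes to
  -- the limit on both sides.
  have hnorm : ‖Y - Finsupp.linearCombination ℂ x β‖ = ‖targetLp hf hb - pastLp hf α‖ := by
    refine tendsto_nhds_unique (hY.sub_const (Finsupp.linearCombination ℂ x β)).norm ?_
    rw [← hyβ]
    refine ((hylim.sub_const (Finsupp.linearCombination ℂ y β)).norm).congr fun N => ?_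
    rw [← map_sub, ← map_sub, hxy]
  have hen : ‖Y - Finsupp.linearCombination ℂ x β‖ₑ ^ 2 = ∫⁻ ω, ‖functionalB T τ d b ξ ω -
      α.sum fun p z => z * component T τ d ξ p.1 (-((p.2 : ℤ) + 1)) ω‖ₑ ^ 2 ∂P := by
    have h := eLpNorm_nnreal_pow_eq_lintegral
      (f := ⇑(Y - Finsupp.linearCombination ℂ x β : Lp ℂ 2 P)) (μ := P) (p := 2) two_ne_zero
    have h2 : ‖Y - Finsupp.linearCombination ℂ x β‖ₑ ^ 2 =
        ∫⁻ ω, ‖(Y - Finsupp.linearCombination ℂ x β : Lp ℂ 2 P) ω‖ₑ ^ 2 ∂P := by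
      rw [Lp.enorm_def]
      simpa using h
    rw [h2]
    refine lintegral_congr_ae ?_
    filter_upwards [hYB, hxβ, Lp.coeFn_sub Y (Finsupp.linearCombination ℂ x β)] with ω h3 h4 h5
    rw [h5, Pi.sub_apply, h3, h4]
  rw [← hen, err_pastComb_eq_enorm hf hb, enorm_sq_eq_ofReal, enorm_sq_eq_ofReal, hnorm]

end Components

end

end Extrapolation

end

/-! ### Assembly of the theorem -/

theorem mainTheorem5 (K : Set ℕ+) (T : ℝ) (hT : 0 < T) (τ d : ℕ) (hτ : 0 < τ)
    (a : ℝ → ℂ) (ha : LocallyIntegrableOn a (Set.Ici 0))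
    (b : ℕ → Extrapolation.Vec K) (hb : Extrapolation.IsDTau T τ d a b)
    (hsum : Summable fun j : ℕ => ((j : ℝ) + 1) * ‖b j‖)
    (D : Set (ℝ → Extrapolation.Vec K →L[ℂ] Extrapolation.Vec K))
    (hD : ∀ f ∈ D, Extrapolation.IsSpectralDensity τ d f)
    (f₀ : ℝ → Extrapolation.Vec K →L[ℂ] Extrapolation.Vec K) (hf₀ : f₀ ∈ D)
    (hmin : Extrapolation.Minimality τ d f₀) :
    -- `F_τ⁻¹ D^τ a` is well defined
    (∀ f ∈ D, Extrapolation.Minimality τ d f →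
      ∃! c : ℕ → Extrapolation.Vec K, Extrapolation.ToeplitzMaps τ d f c b) ∧
    -- `Δ(f)` is the error of the optimal estimate for every process with the density `f`
    (∀ f ∈ D, ∀ (Ω : Type*) [MeasurableSpace Ω] (P : Measure Ω) [IsProbabilityMeasure P]
      (ξ : ℝ → Ω → ℂ), Extrapolation.HasSpectralDensity P T τ d ξ f →
        Extrapolation.extrapolationError P T τ d b ξ = Extrapolation.minErr τ d b f) ∧
    -- if `F_τ⁰` solves the optimization problem, `f₀` is least favourable and `h_τ(f₀)` minimax
    (∀ (c₀ : ℕ → Extrapolation.Vec K) (C₀ : ℝ → Extrapolation.Vec K),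
      Extrapolation.ToeplitzMaps τ d f₀ c₀ b → Extrapolation.HasSeries C₀ c₀ →
      (∀ f ∈ D, Extrapolation.Minimality τ d f →
        ∀ c : ℕ → Extrapolation.Vec K, Extrapolation.ToeplitzMaps τ d f c b →
          (Extrapolation.seqInner b c).re ≤ (Extrapolation.seqInner b c₀).re) →
      (((∀ f ∈ D, Extrapolation.Minimality τ d f) ∨ Convex ℝ D) →
        Extrapolation.IsLeastFavourable τ d b D f₀) ∧
      Extrapolation.IsOptimal τ d b f₀ (Extrapolation.hTau τ d b f₀ C₀) ∧
      (Convex ℝ D → Extrapolation.hTau τ d b f₀ C₀ ∈ Extrapolation.HD τ d D →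
        Extrapolation.IsMinimax τ d b D (Extrapolation.hTau τ d b f₀ C₀))) := by
  -- Minimality of the single density f₀ already makes K finite, so the finite-dimensional arguments
  -- apply to every density of the class.
  have hK : Finite K := Extrapolation.finite_of_minimality hτ (hD f₀ hf₀) hmin
  have hbs : Summable fun j => ‖b j‖ :=
    hsum.of_nonneg_of_le (fun j => norm_nonneg _) fun j =>
      le_mul_of_one_le_left (norm_nonneg _) (by linarith [j.cast_nonneg (α := ℝ)])
  refine ⟨fun f hf hm => ⟨_, Extrapolation.toeplitzMaps_solutionSeq hτ (hD f hf) hm hbs hsum,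
    fun c hc => hc.unique hτ (hD f hf) hm
      (Extrapolation.toeplitzMaps_solutionSeq hτ (hD f hf) hm hbs hsum)⟩,
    fun f hf Ω _ P _ ξ hξ => Extrapolation.extrapolationError_eq_minErr hT (hD f hf) hξ hbs,
    fun c₀ C₀ hc₀ hC₀ hmax => ?_⟩
  have hC : C₀ =ᵐ[Extrapolation.circ] Extrapolation.solutionFun (hD f₀ hf₀) hbs :=
    hc₀.ae_eq_solutionFun hτ (hD f₀ hf₀) hmin hbs hsum hC₀
  have hval := Extrapolation.minErr_eq_seqInner hτ (hD f₀ hf₀) hmin hbs hsum hc₀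
  have hle : ∀ f ∈ D, Extrapolation.Minimality τ d f →
      Extrapolation.minErr τ d b f ≤ Extrapolation.minErr τ d b f₀ := by
    intro f hf hm
    have hc := Extrapolation.toeplitzMaps_solutionSeq hτ (hD f hf) hm hbs hsum
    rw [hval, Extrapolation.minErr_eq_seqInner hτ (hD f hf) hm hbs hsum hc]
    exact ENNReal.ofReal_le_ofReal (hmax f hf hm _ hc)
  have hconv : Convex ℝ D → ∀ f ∈ D,
      Extrapolation.minErr τ d b f ≤ Extrapolation.minErr τ d b f₀ := fun hcv f hf =>
    Extrapolation.minErr_le_of_convex hbs hD hcv hf₀ hmin (by rw [hval]; exact ENNReal.ofReal_ne_top)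
      hle hf
  have hopt := Extrapolation.minErr_eq_err_hTau hτ (hD f₀ hf₀) hmin hbs hC₀.memLp.1 hC
  refine ⟨fun h => ⟨hf₀, fun f hf => ?_⟩,
    ⟨Extrapolation.hTau_mem_L2Past hτ (hD f₀ hf₀) hmin hbs hC₀.memLp.1 hC, hopt.symm⟩,
    fun hcv hHD => ⟨hHD, fun h hh => ?_⟩⟩
  · exact h.elim (fun hall => hle f hf (hall f hf)) fun hcv => hconv hcv f hf
  -- The saddle point chain: the errors of h_τ(f₀) never exceed Δ(f₀), and any competitor already
  -- has error at least Δ(f₀) at f₀.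
  · calc ⨆ f ∈ D, Extrapolation.err τ d b (Extrapolation.hTau τ d b f₀ C₀) f
        ≤ Extrapolation.minErr τ d b f₀ := iSup₂_le fun f hf =>
          Extrapolation.err_hTau_le_of_convex hτ hbs hD hcv hf₀ hmin hC₀.memLp.1 hC
            (hconv hcv) hf
      _ ≤ Extrapolation.err τ d b h f₀ := iInf₂_le h (hh f₀ hf₀)
      _ ≤ ⨆ f ∈ D, Extrapolation.err τ d b h f :=
          le_iSup₂ (f := fun f (_ : f ∈ D) => Extrapolation.err τ d b h f) f₀ hf₀
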